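/- **Theorem.** Let $k\ge 1$ be an integer. Let $N=\mathbb Z^2$, and for a strongly convex rational polyhedral cone $\sigma\subset N\otimes\mathbb R=\mathbb R^2$ let $U_\sigma=\operatorname{Spec}\mathbb C[\sigma^\vee\cap\mathbb Z^2]$. For a fan $\Delta$ in $N$ let $X(\Delta)$ be the toric surface glued from the $U_\sigma$, $\sigma\in\Delta$, and let $\Delta(1)$ denote the set of primitive generators of the rays of $\Delta$. A *desingularization* of $X(\Delta)$ is a (toric) one: the morphism $X(\Delta')\to X(\Delta)$ induced by a fan $\Delta'$ that subdivides $\Delta$ (every cone of $\Delta'$ lies in a cone of $\Delta$, and both fans have the same support) and for which $X(\Delta')$ is nonsingular, i.e. every $U_{\sigma}$, $\sigma\in\Delta'$, is smooth over $\mathbb C$. It is *minimal* if every other desingularization $X(\Delta'')\to X(\Delta)$ of this kind factors through it, i.e. every cone of $\Delta''$ lies in a cone of $\Delta'$. The weighted projective plane $\mathbb P(1,2,2k+1)$ is the complete toric surface whose fan $\Delta$, which is unique, has $\Delta(1)=\{u_0,u_1,u_2\}$ with $u_1=(1,0)$, $u_2=(0,1)$, $u_0=(-2,-(2k+1))$;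 these vectors span $N$ and satisfy $u_0+2u_1+(2k+1)u_2=0$. Then $\mathbb P(1,2,2k+1)$ has exactly one minimal desingularization $\mathbb D(1,2,2k+1)$, and it is the complete toric surface whose fan $\bar\Delta$ has $$\bar\Delta(1)=\left\{\begin{bmatrix}1\\0\end{bmatrix},\begin{bmatrix}0\\1\end{bmatrix},\begin{bmatrix}-1\\-k\end{bmatrix},\begin{bmatrix}-2\\-(2k+1)\end{bmatrix},\begin{bmatrix}-1\\-(k+1)\end{bmatrix},\begin{bmatrix}0\\-1\end{bmatrix}\right\}.$$ That is, a fan in $N$ defines the minimal desingularization of $\mathbb P(1,2,2k+1)$ if and only if it is complete and its set of primitive ray generators is this set. -/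

import Mathlib

namespace ToricSurface

/-- The lattice `N = ℤ²` of one-parameter subgroups. -/
abbrev N : Type := Fin 2 → ℤ

/-- The character lattice `M`, identified with `ℤ²` by the standard dot product. -/
abbrev M : Type := Fin 2 → ℤ

/-- The real vector space `N_ℝ = N ⊗ ℝ = ℝ²`. -/
abbrev NReal : Type := Fin 2 → ℝ

/-- The inclusion of the lattice `N` in `N_ℝ`. -/
def toReal (v : N) : NReal := fun i => (v i : ℝ)

/-- The cone in `N_ℝ` generated over `ℝ≥0` by a set of lattice vectors. -/
def latticeCone (S : Set N) : PointedCone ℝ NReal := PointedCone.hull ℝ (toReal '' S)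

/-- A fan in `N = ℤ²`: a finite collection of strongly convex rational polyhedral cones, closed
under taking faces, and such that any two of its cones meet in a common face. -/
@[ext] structure Fan where
  cones : Set (PointedCone ℝ NReal)
  finite : cones.Finite
  rational : ∀ σ ∈ cones, ∃ S : Set N, S.Finite ∧ σ = latticeCone S
  stronglyConvex : ∀ σ ∈ cones, σ.toConvexCone.Salient
  face_mem : ∀ σ ∈ cones, ∀ τ : PointedCone ℝ NReal, τ.IsFaceOf σ → τ ∈ cones
  inf_isFaceOf : ∀ σ ∈ cones, ∀ τ ∈ cones, (σ ⊓ τ).IsFaceOf σ ∧ (σ ⊓ τ).IsFaceOf τ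

/-- The support `|Δ|`: the union of the cones of the fan. -/
def Fan.support (Δ : Fan) : Set NReal := {x | ∃ σ ∈ Δ.cones, x ∈ σ}

/-- A fan is complete if its cones cover `N_ℝ`. -/
def Fan.IsComplete (Δ : Fan) : Prop := Δ.support = Set.univ

/-- `Δ(1)`: the primitive lattice vectors on the one-dimensional cones of the fan. -/
def Fan.rayGenerators (Δ : Fan) : Set N :=
  {v | IsCoprime (v 0) (v 1) ∧ latticeCone {v} ∈ Δ.cones}

/-- The monoid `σ^∨ ∩ M` of the characters that are nonnegative on `σ`. -/
def dualMonoid (σ : PointedCone ℝ NReal) : AddSubmonoid M where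
  carrier := {m | ∀ x ∈ σ, 0 ≤ ∑ i, (m i : ℝ) * x i}
  zero_mem' := by
    intro x _
    simp
  add_mem' := by
    intro a b ha hb x hx
    have h := add_nonneg (ha x hx) (hb x hx)
    rw [← Finset.sum_add_distrib] at h
    simpa only [Pi.add_apply, Int.cast_add, add_mul] using h

/-- The coordinate ring `ℂ[σ^∨ ∩ M]` of the affine toric variety `U_σ`. -/
abbrev coordinateRing (σ : PointedCone ℝ NReal) : Type := AddMonoidAlgebra ℂ (dualMonoid σ)

/-- The toric surface `X(Δ)` is nonsingular: each chart `U_σ = Spec ℂ[σ^∨ ∩ M]` of its affine open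
cover is smooth over `ℂ`. -/
def Fan.IsNonsingular (Δ : Fan) : Prop :=
  ∀ σ ∈ Δ.cones, Algebra.Smooth ℂ (coordinateRing σ)

/-- Every cone of `Δ'` lies in a cone of `Δ`: the identity of `N` induces a toric morphism
`X(Δ') → X(Δ)`. -/
def Fan.MapsTo (Δ' Δ : Fan) : Prop := ∀ σ' ∈ Δ'.cones, ∃ σ ∈ Δ.cones, σ' ≤ σ

/-- `Δ'` subdivides `Δ`: the toric morphism `X(Δ') → X(Δ)` exists and, the supports being equal, it
is proper and birational. -/
def Fan.IsSubdivision (Δ' Δ : Fan) : Prop := Δ'.MapsTo Δ ∧ Δ'.support = Δ.support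

/-- `X(Δ') → X(Δ)` is a (toric) desingularization. -/
def Fan.IsDesingularization (Δ' Δ : Fan) : Prop := Δ'.IsSubdivision Δ ∧ Δ'.IsNonsingular

/-- `X(Δ') → X(Δ)` is the minimal desingularization: it is a desingularization through which every
other one factors. -/
def Fan.IsMinimalDesingularization (Δ' Δ : Fan) : Prop :=
  Δ'.IsDesingularization Δ ∧ ∀ Δ'' : Fan, Δ''.IsDesingularization Δ → Δ''.MapsTo Δ'

/-- `Δ` is the fan of the weighted projective plane `ℙ(l, m, n)` with rays through `u₀, u₁, u₂`: it
is complete, `Δ(1) = {u₀, u₁, u₂}`, these vectors span `N` and `l u₀ + m u₁ + n u₂ = 0`. -/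
def Fan.IsWeightedProjectivePlane (Δ : Fan) (l m n : ℕ) (u₀ u₁ u₂ : N) : Prop :=
  Δ.IsComplete ∧ Δ.rayGenerators = {u₀, u₁, u₂} ∧
    Submodule.span ℤ ({u₀, u₁, u₂} : Set N) = ⊤ ∧ l • u₀ + m • u₁ + n • u₂ = 0

end ToricSurface

/-! A complete fan in the plane is determined by its rays. Every strongly convex rational cone is
zero, a ray or spanned by two primitive vectors (`isStandardCone_of_salient`), and the
two-dimensional cones of a fan join angularly adjacent rays. Cones built this way from a fixed set
of rays have disjoint relative interiors (`FanCone.eq_of_inRelint`), so completeness forces all of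
them to occur. It therefore suffices to study two explicit fans, `planeFan` and `resolutionFan`.

Smoothness becomes arithmetic: the chart of a cone on primitive `v`, `w` with `det v w > 0` is
smooth exactly when `det v w = 1`. If the determinant is 1, the dual monoid is `ℕ²`, whose
homomorphisms lift along square-zero ideals. If it is larger, a relation `d g = e + q f` with `e`,
`f` irreducible yields a tangent vector that does not extend to a truncated arc
(`not_formallySmooth_of_relation`).

For minimality, take a two-dimensional cone `⟨v, w⟩` of any desingularization. It is unimodular and
lies in a cone of the plane fan. A lattice point `u` in its interior is a combination of `v` and `w`
with positive integral coefficients, so an integral functional positive on the nonzero lattice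
points of the big cone is at least 2 at `u`. Every ray of the resolution in the big cone has value 1
under such a functional, so none passes through the interior of `⟨v, w⟩` (`not_mem_interior`), and
`⟨v, w⟩` lies in a cone of the resolution. Uniqueness holds because mutual refinement implies
equality of fans. -/

namespace ToricSurface

/-! ### Determinants, primitive vectors and cones on at most two generators -/

/-- The determinant of a pair of lattice vectors. -/
def det (v w : N) : ℤ := v 0 * w 1 - v 1 * w 0

/-- The determinant of a pair of vectors of `N_ℝ`. -/
def rdet (x y : NReal) : ℝ := x 0 * y 1 - x 1 * y 0

@[simp] lemma toReal_apply (v : N) (i : Fin 2) : toReal v i = (v i : ℝ) := rfl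

@[simp] lemma rdet_toReal (v w : N) : rdet (toReal v) (toReal w) = (det v w : ℝ) := by
  simp [rdet, det]

lemma rdet_smul_add (v : NReal) (a b : ℝ) (x y : NReal) :
    rdet v (a • x + b • y) = a * rdet v x + b * rdet v y := by
  simp [rdet]; ring

lemma rdet_add (v x y : NReal) : rdet v (x + y) = rdet v x + rdet v y := by
  simp [rdet]; ring

lemma rdet_smul (v : NReal) (a : ℝ) (x : NReal) : rdet v (a • x) = a * rdet v x := by
  simp [rdet]; ring

@[simp] lemma rdet_zero (v : NReal) : rdet v 0 = 0 := by simp [rdet]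

lemma rdet_swap (x y : NReal) : rdet y x = - rdet x y := by simp [rdet]; ring

lemma rdet_self (x : NReal) : rdet x x = 0 := by simp [rdet]; ring

lemma det_swap (x y : N) : det y x = - det x y := by simp [det]; ring

lemma toReal_injective : Function.Injective toReal := fun v w h => by
  ext i
  exact_mod_cast (show (v i : ℝ) = w i from congrFun h i)

lemma toReal_ne_zero {v : N} (hv : v ≠ 0) : toReal v ≠ 0 := fun h =>
  hv (toReal_injective (h.trans (by ext; simp)))

lemma ne_zero_of_isCoprime {v : N} (hv : IsCoprime (v 0) (v 1)) : v ≠ 0 := by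
  rintro rfl
  exact not_isCoprime_zero_zero hv

lemma mem_latticeCone_pair {v w : N} {x : NReal} :
    x ∈ latticeCone {v, w} ↔
      ∃ a b : ℝ, 0 ≤ a ∧ 0 ≤ b ∧ x = a • toReal v + b • toReal w := by
  rw [latticeCone, Set.image_pair, PointedCone.hull, Submodule.mem_span_pair]
  constructor
  · rintro ⟨a, b, rfl⟩
    exact ⟨a, b, a.2, b.2, rfl⟩
  · rintro ⟨a, b, ha, hb, rfl⟩
    exact ⟨⟨a, ha⟩, ⟨b, hb⟩, rfl⟩

lemma mem_latticeCone_singleton {v : N} {x : NReal} :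
    x ∈ latticeCone {v} ↔ ∃ a : ℝ, 0 ≤ a ∧ x = a • toReal v := by
  rw [latticeCone, Set.image_singleton, PointedCone.hull, Submodule.mem_span_singleton]
  constructor
  · rintro ⟨a, rfl⟩
    exact ⟨a, a.2, rfl⟩
  · rintro ⟨a, ha, rfl⟩
    exact ⟨⟨a, ha⟩, rfl⟩

lemma latticeCone_empty : latticeCone ∅ = ⊥ := by
  simp [latticeCone, PointedCone.hull]

lemma latticeCone_le {S : Set N} {σ : PointedCone ℝ NReal} :
    latticeCone S ≤ σ ↔ ∀ v ∈ S, toReal v ∈ σ := by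
  rw [latticeCone, PointedCone.hull, Submodule.span_le, Set.image_subset_iff]
  rfl

lemma toReal_mem_latticeCone {S : Set N} {v : N} (hv : v ∈ S) : toReal v ∈ latticeCone S :=
  Submodule.subset_span ⟨v, hv, rfl⟩

lemma latticeCone_mono {S T : Set N} (h : S ⊆ T) : latticeCone S ≤ latticeCone T :=
  latticeCone_le.2 fun _ hv => toReal_mem_latticeCone (h hv)

/-- Cramer's rule without division; it turns membership in a two-dimensional cone into two sign
conditions. -/
lemma rdet_smul_eq (v w x : NReal) : rdet v w • x = rdet x w • v + rdet v x • w := by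
  ext i
  fin_cases i <;> simp [rdet] <;> ring

lemma mem_latticeCone_pair_iff {v w : N} (h : 0 < det v w) {x : NReal} :
    x ∈ latticeCone {v, w} ↔ 0 ≤ rdet (toReal v) x ∧ 0 ≤ rdet x (toReal w) := by
  have h' : (0 : ℝ) < rdet (toReal v) (toReal w) := by
    rw [rdet_toReal]
    exact_mod_cast h
  rw [mem_latticeCone_pair]
  constructor
  · rintro ⟨a, b, ha, hb, rfl⟩
    rw [rdet_swap (toReal w), rdet_smul_add, rdet_smul_add, rdet_self, rdet_self,
      rdet_swap (toReal v) (toReal w)]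
    constructor
    · simpa using mul_nonneg hb h'.le
    · simpa using mul_nonneg ha h'.le
  · rintro ⟨h1, h2⟩
    refine ⟨rdet x (toReal w) / rdet (toReal v) (toReal w),
      rdet (toReal v) x / rdet (toReal v) (toReal w), by positivity, by positivity, ?_⟩
    apply smul_right_injective _ h'.ne'
    simp only [smul_add, smul_smul, mul_div_cancel₀ _ h'.ne']
    exact rdet_smul_eq _ _ _

lemma toReal_mem_latticeCone_pair_iff {v w u : N} (h : 0 < det v w) :
    toReal u ∈ latticeCone {v, w} ↔ 0 ≤ det v u ∧ 0 ≤ det u w := by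
  rw [mem_latticeCone_pair_iff h, rdet_toReal, rdet_toReal, Int.cast_nonneg_iff,
    Int.cast_nonneg_iff]

/-- A lattice vector parallel to a primitive vector is an integral multiple of it. -/
lemma exists_eq_smul_of_det_eq_zero {v u : N} (hv : IsCoprime (v 0) (v 1)) (h : det v u = 0) :
    ∃ c : ℤ, u = c • v := by
  obtain ⟨a, b, hab⟩ := hv
  refine ⟨a * u 0 + b * u 1, ?_⟩
  simp only [det] at h
  ext i
  fin_cases i
  · simp
    linear_combination (-u 0) * hab - b * h
  · simp
    linear_combination (-u 1) * hab + a * h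

lemma exists_eq_smul_primitive {u : N} (hu : u ≠ 0) :
    ∃ (v : N) (c : ℤ), IsCoprime (v 0) (v 1) ∧ 0 < c ∧ u = c • v := by
  have hg : 0 < Int.gcd (u 0) (u 1) := by
    rw [Nat.pos_iff_ne_zero, Ne, Int.gcd_eq_zero_iff]
    rintro ⟨h0, h1⟩
    apply hu
    ext i
    fin_cases i <;> assumption
  obtain ⟨a, b, hab, ha, hb⟩ := Int.exists_gcd_one hg
  refine ⟨![a, b], Int.gcd (u 0) (u 1), by simpa [Int.isCoprime_iff_gcd_eq_one] using hab,
    by exact_mod_cast hg, ?_⟩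
  ext i
  fin_cases i
  · simpa [mul_comm] using ha
  · simpa [mul_comm] using hb

lemma eq_of_smul_eq_smul {v u : N} (hv : IsCoprime (v 0) (v 1)) (hu : IsCoprime (u 0) (u 1))
    {a b : ℝ} (ha : 0 < a) (hb : 0 < b) (h : a • toReal v = b • toReal u) : v = u := by
  have hd : det v u = 0 := by
    have : b * rdet (toReal v) (toReal u) = 0 := by
      rw [← rdet_smul, ← h, rdet_smul, rdet_self, mul_zero]
    simpa [hb.ne'] using this
  obtain ⟨c, rfl⟩ := exists_eq_smul_of_det_eq_zero hv hd
  -- A Bézout relation for `c • v` exhibits an inverse of `c`; the sign -1 is then excluded by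
  -- positivity of `a + b`.
  have hcu : IsUnit c := by
    obtain ⟨p, q, hpq⟩ := hu
    refine IsUnit.of_mul_eq_one (p * v 0 + q * v 1) ?_
    rw [← hpq]
    simp
    ring
  have hvr := toReal_ne_zero (ne_zero_of_isCoprime hv)
  rcases Int.isUnit_iff.1 hcu with rfl | rfl
  · simp
  · exfalso
    have : (a + b) • toReal v = 0 := by
      rw [add_smul, h]
      ext i
      simp
    rcases smul_eq_zero.1 this with h1 | h1
    · linarith
    · exact hvr h1

lemma latticeCone_singleton_injective {v u : N} (hv : IsCoprime (v 0) (v 1))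
    (hu : IsCoprime (u 0) (u 1)) (h : latticeCone {v} = latticeCone {u}) : v = u := by
  have : toReal v ∈ latticeCone {u} := h ▸ toReal_mem_latticeCone rfl
  obtain ⟨a, ha, hx⟩ := mem_latticeCone_singleton.1 this
  have ha' : 0 < a := ha.lt_of_ne (by
    rintro rfl
    exact toReal_ne_zero (ne_zero_of_isCoprime hv) (by simpa using hx))
  exact eq_of_smul_eq_smul hv hu one_pos ha' (by simpa using hx)

lemma latticeCone_singleton_smul (v : N) {c : ℤ} (hc : 0 < c) :
    latticeCone {c • v} = latticeCone {v} := by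
  have hc' : (0 : ℝ) < c := by exact_mod_cast hc
  have h : toReal (c • v) = (c : ℝ) • toReal v := by ext i; simp
  apply le_antisymm <;> refine latticeCone_le.2 ?_ <;> rintro _ rfl <;>
    rw [mem_latticeCone_singleton]
  · exact ⟨c, hc'.le, h⟩
  · exact ⟨(c : ℝ)⁻¹, by positivity, by rw [h, smul_smul, inv_mul_cancel₀ hc'.ne', one_smul]⟩

lemma latticeCone_union (S T : Set N) : latticeCone (S ∪ T) = latticeCone S ⊔ latticeCone T := by
  rw [latticeCone, Set.image_union, PointedCone.hull, Submodule.span_union]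
  rfl

/-! ### Faces -/

lemma isFaceOf_bot {σ : PointedCone ℝ NReal} (hσ : σ.toConvexCone.Salient) :
    PointedCone.IsFaceOf ⊥ σ where
  le := bot_le
  mem_of_smul_add_mem := by
    intro x y a hx hy ha h
    rw [Submodule.mem_bot] at h ⊢
    by_contra hx0
    refine hσ (a • x) (σ.smul_mem ha.le hx) (smul_ne_zero ha.ne' hx0) ?_
    rwa [neg_eq_of_add_eq_zero_right h]

lemma salient_latticeCone_singleton {v : N} (hv : v ≠ 0) :
    (latticeCone {v}).toConvexCone.Salient := by
  intro x hx hx0 hx'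
  obtain ⟨a, ha, rfl⟩ := mem_latticeCone_singleton.1 hx
  obtain ⟨b, hb, h⟩ := mem_latticeCone_singleton.1 hx'
  have : (a + b) • toReal v = 0 := by
    rw [add_smul, ← h]
    simp
  rcases smul_eq_zero.1 this with h1 | h1
  · obtain rfl : a = 0 := by linarith
    simp at hx0
  · exact toReal_ne_zero hv h1

lemma eq_zero_of_rdet_eq_zero {v w x : NReal} (h : rdet v w ≠ 0) (h1 : rdet v x = 0)
    (h2 : rdet x w = 0) : x = 0 := by
  have := rdet_smul_eq v w x
  rw [h1, h2, zero_smul, zero_smul, zero_add] at this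
  exact (smul_eq_zero.1 this).resolve_left h

lemma rdet_neg_right (x y : NReal) : rdet x (-y) = -rdet x y := by simp [rdet]; ring

lemma rdet_neg_left (x y : NReal) : rdet (-x) y = -rdet x y := by simp [rdet]; ring

lemma rdet_toReal_ne_zero {v w : N} (h : 0 < det v w) : rdet (toReal v) (toReal w) ≠ 0 := by
  rw [rdet_toReal]
  exact_mod_cast h.ne'

lemma salient_latticeCone_pair {v w : N} (h : 0 < det v w) :
    (latticeCone {v, w}).toConvexCone.Salient := by
  intro x hx hx0 hx'
  obtain ⟨h1, h2⟩ := (mem_latticeCone_pair_iff h).1 hx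
  obtain ⟨h3, h4⟩ := (mem_latticeCone_pair_iff h).1 hx'
  rw [rdet_neg_right] at h3
  rw [rdet_neg_left] at h4
  exact hx0 (eq_zero_of_rdet_eq_zero (rdet_toReal_ne_zero h) (by linarith) (by linarith))

/-- The functional `rdet v` is nonnegative on the cone and vanishes there only along `v`. -/
lemma isFaceOf_left {v w : N} (h : 0 < det v w) :
    (latticeCone {v}).IsFaceOf (latticeCone {v, w}) where
  le := latticeCone_mono (by simp)
  mem_of_smul_add_mem := by
    intro x y a hx hy ha hxy
    obtain ⟨b, hb, hxy⟩ := mem_latticeCone_singleton.1 hxy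
    obtain ⟨p, q, hp, hq, rfl⟩ := mem_latticeCone_pair.1 hx
    have h2 := ((mem_latticeCone_pair_iff h).1 hy).1
    have h' : (0 : ℝ) < det v w := by exact_mod_cast h
    have h3 := congrArg (rdet (toReal v)) hxy
    rw [rdet_add, rdet_smul, rdet_smul_add, rdet_smul, rdet_self, rdet_toReal] at h3
    have h4 : a * (q * det v w) ≤ 0 := by nlinarith
    have h5 : q * det v w ≤ 0 := nonpos_of_mul_nonpos_right h4 ha
    obtain rfl : q = 0 := le_antisymm (nonpos_of_mul_nonpos_left h5 h') hq
    exact mem_latticeCone_singleton.2 ⟨p, hp, by simp⟩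

lemma isFaceOf_right {v w : N} (h : 0 < det v w) :
    (latticeCone {w}).IsFaceOf (latticeCone {v, w}) where
  le := latticeCone_mono (by simp)
  mem_of_smul_add_mem := by
    intro x y a hx hy ha hxy
    obtain ⟨b, hb, hxy⟩ := mem_latticeCone_singleton.1 hxy
    obtain ⟨p, q, hp, hq, rfl⟩ := mem_latticeCone_pair.1 hx
    have h2 := ((mem_latticeCone_pair_iff h).1 hy).2
    have h' : (0 : ℝ) < det v w := by exact_mod_cast h
    rw [rdet_swap (toReal w)] at h2
    have h3 := congrArg (rdet (toReal w)) hxy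
    rw [rdet_add, rdet_smul, rdet_smul_add, rdet_smul, rdet_self,
      rdet_swap (toReal v) (toReal w), rdet_toReal] at h3
    have h4 : a * (p * det v w) ≤ 0 := by nlinarith
    have h5 : p * det v w ≤ 0 := nonpos_of_mul_nonpos_right h4 ha
    obtain rfl : p = 0 := le_antisymm (nonpos_of_mul_nonpos_left h5 h') hp
    exact mem_latticeCone_singleton.2 ⟨q, hq, by simp⟩

lemma eq_bot_or_eq_of_isFaceOf_singleton {v : N} {τ : PointedCone ℝ NReal}
    (h : τ.IsFaceOf (latticeCone {v})) : τ = ⊥ ∨ τ = latticeCone {v} := by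
  by_cases hv : toReal v ∈ τ
  · exact Or.inr (le_antisymm h.le (latticeCone_le.2 (by rintro _ rfl; exact hv)))
  · refine Or.inl (eq_bot_iff.2 fun x hx => ?_)
    obtain ⟨a, ha, rfl⟩ := mem_latticeCone_singleton.1 (h.le hx)
    rcases ha.eq_or_lt with rfl | ha
    · simp
    · exact absurd (h.mem_of_smul_add_mem (x := toReal v) (y := 0) (toReal_mem_latticeCone rfl)
        (zero_mem _) ha (by simpa using hx)) hv

/-- A face containing `a v + b w` contains each generator whose coefficient is positive, so it is
determined by which of `v`, `w` it contains. -/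
lemma eq_of_isFaceOf_pair {v w : N} {τ : PointedCone ℝ NReal}
    (h : τ.IsFaceOf (latticeCone {v, w})) :
    τ = ⊥ ∨ τ = latticeCone {v} ∨ τ = latticeCone {w} ∨ τ = latticeCone {v, w} := by
  have hvm : toReal v ∈ latticeCone {v, w} := toReal_mem_latticeCone (by simp)
  have hwm : toReal w ∈ latticeCone {v, w} := toReal_mem_latticeCone (by simp)
  have key : ∀ x ∈ τ, ∃ a b : ℝ, 0 ≤ a ∧ 0 ≤ b ∧ x = a • toReal v + b • toReal w ∧
      (0 < a → toReal v ∈ τ) ∧ (0 < b → toReal w ∈ τ) := by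
    intro x hx
    obtain ⟨a, b, ha, hb, rfl⟩ := mem_latticeCone_pair.1 (h.le hx)
    refine ⟨a, b, ha, hb, rfl, fun ha' => ?_, fun hb' => ?_⟩
    · exact h.mem_of_smul_add_mem hvm (PointedCone.smul_mem _ hb hwm) ha' hx
    · exact h.mem_of_smul_add_mem hwm (PointedCone.smul_mem _ ha hvm) hb' (by rwa [add_comm])
  by_cases hv : toReal v ∈ τ <;> by_cases hw : toReal w ∈ τ
  · refine Or.inr (Or.inr (Or.inr (le_antisymm h.le (latticeCone_le.2 ?_))))
    rintro _ (rfl | rfl) <;> assumption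
  · refine Or.inr (Or.inl (le_antisymm (fun x hx => ?_) (latticeCone_le.2 ?_)))
    · obtain ⟨a, b, ha, hb, rfl, -, h2⟩ := key x hx
      obtain rfl : b = 0 := hb.antisymm' (not_lt.1 fun h3 => hw (h2 h3))
      exact mem_latticeCone_singleton.2 ⟨a, ha, by simp⟩
    · rintro _ rfl
      exact hv
  · refine Or.inr (Or.inr (Or.inl (le_antisymm (fun x hx => ?_) (latticeCone_le.2 ?_))))
    · obtain ⟨a, b, ha, hb, rfl, h1, -⟩ := key x hx
      obtain rfl : a = 0 := ha.antisymm' (not_lt.1 fun h3 => hv (h1 h3))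
      exact mem_latticeCone_singleton.2 ⟨b, hb, by simp⟩
    · rintro _ rfl
      exact hw
  · refine Or.inl (eq_bot_iff.2 fun x hx => ?_)
    obtain ⟨a, b, ha, hb, rfl, h1, h2⟩ := key x hx
    obtain rfl : a = 0 := ha.antisymm' (not_lt.1 fun h3 => hv (h1 h3))
    obtain rfl : b = 0 := hb.antisymm' (not_lt.1 fun h3 => hw (h2 h3))
    simp

/-! ### Classification of strongly convex rational cones in the plane -/

/-- A strongly convex rational cone in the plane is zero, a ray or spanned by two primitive
vectors. -/
inductive IsStandardCone : PointedCone ℝ NReal → Prop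
  | bot : IsStandardCone ⊥
  | ray (v : N) (hv : IsCoprime (v 0) (v 1)) : IsStandardCone (latticeCone {v})
  | pair (v w : N) (hv : IsCoprime (v 0) (v 1)) (hw : IsCoprime (w 0) (w 1)) (h : 0 < det v w) :
      IsStandardCone (latticeCone {v, w})

lemma latticeCone_pair_eq_sup (v w : N) :
    latticeCone {v, w} = latticeCone {v} ⊔ latticeCone {w} := by
  rw [← latticeCone_union]; rfl

lemma toReal_neg (v : N) : toReal (-v) = - toReal v := by ext; simp

/-- The signs of `det v s` and `det s w` tell whether `s` is already in the cone or replaces one of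
its edges. The remaining case puts `-s` in the cone, against salience. -/
lemma isStandardCone_sup {s : N} (hs : IsCoprime (s 0) (s 1)) {σ : PointedCone ℝ NReal}
    (hσ : IsStandardCone σ) (hsal : (σ ⊔ latticeCone {s}).toConvexCone.Salient) :
    IsStandardCone (σ ⊔ latticeCone {s}) := by
  have hs0 := toReal_ne_zero (ne_zero_of_isCoprime hs)
  have hneg : -toReal s ∉ σ := fun h => hsal (toReal s)
    ((le_sup_right : _ ≤ σ ⊔ latticeCone {s}) (toReal_mem_latticeCone rfl)) hs0
    ((le_sup_left : σ ≤ _) h)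
  have hsmem : toReal s ∈ σ → IsStandardCone (σ ⊔ latticeCone {s}) := fun h => by
    rwa [sup_eq_left.2 (latticeCone_le.2 (by rintro _ rfl; exact h))]
  cases hσ with
  | bot => rw [bot_sup_eq]; exact .ray s hs
  | ray v hv =>
    rcases lt_trichotomy (det v s) 0 with h | h | h
    · rw [sup_comm, ← latticeCone_pair_eq_sup]
      exact .pair s v hs hv (by rw [det_swap]; omega)
    · obtain ⟨c, rfl⟩ := exists_eq_smul_of_det_eq_zero hv h
      have h1 : toReal (c • v) = (c : ℝ) • toReal v := by ext; simp
      rcases le_total 0 c with hc | hc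
      · exact hsmem (mem_latticeCone_singleton.2 ⟨c, by exact_mod_cast hc, h1⟩)
      · refine absurd (mem_latticeCone_singleton.2 ⟨-c, ?_, ?_⟩) hneg
        · have : (c : ℝ) ≤ 0 := by exact_mod_cast hc
          linarith
        · rw [h1, neg_smul]
    · rw [← latticeCone_pair_eq_sup]
      exact .pair v s hv hs h
  | pair v w hv hw hd =>
    rw [← toReal_neg, toReal_mem_latticeCone_pair_iff hd] at hneg
    rw [toReal_mem_latticeCone_pair_iff hd] at hsmem
    have e1 : det v (-s) = - det v s := by simp [det]; ring
    have e2 : det (-s) w = - det s w := by simp [det]; ring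
    rw [e1, e2] at hneg
    rcases le_or_gt 0 (det v s) with h1 | h1 <;> rcases le_or_gt 0 (det s w) with h2 | h2
    · exact hsmem ⟨h1, h2⟩
    · have h3 : 0 < det v s := by omega
      have h4 : latticeCone {v, w} ⊔ latticeCone {s} = latticeCone {v, s} := by
        refine le_antisymm (sup_le (latticeCone_le.2 ?_) (latticeCone_mono (by simp)))
          (latticeCone_le.2 ?_)
        · rintro _ (rfl | rfl)
          · exact toReal_mem_latticeCone (by simp)
          · rw [toReal_mem_latticeCone_pair_iff h3]
            exact ⟨hd.le, by rw [det_swap]; omega⟩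
        · rintro _ (rfl | rfl)
          · exact (le_sup_left : latticeCone _ ≤ _) (toReal_mem_latticeCone (by simp))
          · exact (le_sup_right : latticeCone _ ≤ _) (toReal_mem_latticeCone (by simp))
      rw [h4]
      exact .pair v s hv hs h3
    · have h3 : 0 < det s w := by omega
      have h4 : latticeCone {v, w} ⊔ latticeCone {s} = latticeCone {s, w} := by
        refine le_antisymm (sup_le (latticeCone_le.2 ?_) (latticeCone_mono (by simp)))
          (latticeCone_le.2 ?_)
        · rintro _ (rfl | rfl)
          · rw [toReal_mem_latticeCone_pair_iff h3]
            exact ⟨by rw [det_swap]; omega, hd.le⟩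
          · exact toReal_mem_latticeCone (by simp)
        · rintro _ (rfl | rfl)
          · exact (le_sup_right : latticeCone _ ≤ _) (toReal_mem_latticeCone (by simp))
          · exact (le_sup_left : latticeCone _ ≤ _) (toReal_mem_latticeCone (by simp))
      rw [h4]
      exact .pair s w hs hw h3
    · exact absurd ⟨by omega, by omega⟩ hneg

theorem isStandardCone_of_salient {S : Set N} (hS : S.Finite)
    (hsal : (latticeCone S).toConvexCone.Salient) : IsStandardCone (latticeCone S) := by
  induction S, hS using Set.Finite.induction_on with
  | empty => rw [latticeCone_empty]; exact .bot
  | @insert s S _ _ ih =>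
    have ih' := ih (hsal.anti (latticeCone_mono (Set.subset_insert s S)))
    have h1 : latticeCone (insert s S) = latticeCone S ⊔ latticeCone {s} := by
      rw [sup_comm, ← latticeCone_union]; rfl
    rw [h1] at hsal ⊢
    by_cases hs : s = 0
    · subst hs
      rwa [sup_eq_left.2 (latticeCone_le.2 ?_)]
      rintro _ rfl
      convert zero_mem (latticeCone S)
      ext; simp
    · obtain ⟨v, c, hv, hc, rfl⟩ := exists_eq_smul_primitive hs
      rw [latticeCone_singleton_smul v hc] at hsal ⊢
      exact isStandardCone_sup hv ih' hsal

lemma IsStandardCone.salient {σ : PointedCone ℝ NReal} (hσ : IsStandardCone σ) :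
    σ.toConvexCone.Salient := by
  cases hσ with
  | bot => intro x hx hx0; exact absurd hx hx0
  | ray v hv => exact salient_latticeCone_singleton (ne_zero_of_isCoprime hv)
  | pair v w _ _ h => exact salient_latticeCone_pair h

lemma Fan.isStandardCone (Δ : Fan) {σ : PointedCone ℝ NReal} (hσ : σ ∈ Δ.cones) :
    IsStandardCone σ := by
  obtain ⟨S, hS, rfl⟩ := Δ.rational σ hσ
  exact isStandardCone_of_salient hS (Δ.stronglyConvex _ hσ)

/-! ### Relative interiors -/

/-- `z` lies in the relative interior of `σ`: in `σ`, and in no proper face of `σ`. -/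
def InRelint (z : NReal) (σ : PointedCone ℝ NReal) : Prop :=
  z ∈ σ ∧ ∀ τ : PointedCone ℝ NReal, τ.IsFaceOf σ → z ∈ τ → τ = σ

/-- The required face is the smallest one through `z`, the intersection of all faces containing it.
-/
lemma exists_isFaceOf_inRelint {z : NReal} {σ : PointedCone ℝ NReal} (hz : z ∈ σ) :
    ∃ τ : PointedCone ℝ NReal, τ.IsFaceOf σ ∧ InRelint z τ := by
  set F : Set (PointedCone ℝ NReal) := {τ | τ.IsFaceOf σ ∧ z ∈ τ} with hF
  have hface : (σ ⊓ sInf F).IsFaceOf σ := PointedCone.IsFaceOf.sInf F fun f hf => hf.1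
  refine ⟨σ ⊓ sInf F, hface, ⟨hz, ?_⟩, fun τ hτ hzτ => le_antisymm hτ.le ?_⟩
  · exact Submodule.mem_sInf.2 fun τ hτ => hτ.2
  · exact inf_le_right.trans (sInf_le ⟨hτ.trans hface, hzτ⟩)

lemma inRelint_bot {z : NReal} (h : InRelint z ⊥) : z = 0 := h.1

lemma inRelint_ray {z : NReal} {v : N} (hv : IsCoprime (v 0) (v 1))
    (h : InRelint z (latticeCone {v})) : ∃ a : ℝ, 0 < a ∧ z = a • toReal v := by
  obtain ⟨a, ha, rfl⟩ := mem_latticeCone_singleton.1 h.1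
  refine ⟨a, ha.lt_of_ne ?_, rfl⟩
  rintro rfl
  have hv0 := ne_zero_of_isCoprime hv
  have h1 := h.2 ⊥ (isFaceOf_bot (salient_latticeCone_singleton hv0)) (by simp)
  have h2 : toReal v ∈ (⊥ : PointedCone ℝ NReal) := h1 ▸ toReal_mem_latticeCone rfl
  exact toReal_ne_zero hv0 h2

lemma inRelint_pair_iff {z : NReal} {v w : N} (hd : 0 < det v w) :
    InRelint z (latticeCone {v, w}) ↔ 0 < rdet (toReal v) z ∧ 0 < rdet z (toReal w) := by
  have hd' : (0 : ℝ) < det v w := by exact_mod_cast hd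
  constructor
  · intro h
    obtain ⟨a, b, ha, hb, rfl⟩ := mem_latticeCone_pair.1 h.1
    have ha' : a ≠ 0 := by
      rintro rfl
      have h1 := h.2 _ (isFaceOf_right hd) (mem_latticeCone_singleton.2 ⟨b, hb, by simp⟩)
      have h2 : toReal v ∈ latticeCone {w} := h1 ▸ toReal_mem_latticeCone (by simp)
      obtain ⟨c, -, hc⟩ := mem_latticeCone_singleton.1 h2
      have h3 := congrArg (rdet (toReal w)) hc
      rw [rdet_smul, rdet_self, rdet_swap (toReal v), rdet_toReal] at h3
      linarith
    have hb' : b ≠ 0 := by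
      rintro rfl
      have h1 := h.2 _ (isFaceOf_left hd) (mem_latticeCone_singleton.2 ⟨a, ha, by simp⟩)
      have h2 : toReal w ∈ latticeCone {v} := h1 ▸ toReal_mem_latticeCone (by simp)
      obtain ⟨c, -, hc⟩ := mem_latticeCone_singleton.1 h2
      have h3 := congrArg (rdet (toReal v)) hc
      rw [rdet_smul, rdet_self, rdet_toReal] at h3
      linarith
    have ha'' : 0 < a := ha.lt_of_ne' ha'
    have hb'' : 0 < b := hb.lt_of_ne' hb'
    rw [rdet_swap (toReal w), rdet_smul_add, rdet_smul_add, rdet_self, rdet_self,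
      rdet_swap (toReal v) (toReal w), rdet_toReal]
    constructor
    · simpa using mul_pos hb'' hd'
    · simpa using mul_pos ha'' hd'
  · rintro ⟨h1, h2⟩
    refine ⟨(mem_latticeCone_pair_iff hd).2 ⟨h1.le, h2.le⟩, fun τ hτ hz => ?_⟩
    rcases eq_of_isFaceOf_pair hτ with rfl | rfl | rfl | rfl
    · rw [Submodule.mem_bot] at hz
      simp [hz] at h1
    · obtain ⟨a, -, rfl⟩ := mem_latticeCone_singleton.1 hz
      simp [rdet_smul, rdet_self] at h1
    · obtain ⟨a, -, rfl⟩ := mem_latticeCone_singleton.1 hz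
      rw [rdet_swap, rdet_smul, rdet_self] at h2
      simp at h2
    · rfl

lemma inRelint_add {v w : N} (hd : 0 < det v w) :
    InRelint (toReal v + toReal w) (latticeCone {v, w}) := by
  have hd' : (0 : ℝ) < det v w := by exact_mod_cast hd
  rw [inRelint_pair_iff hd, rdet_swap (toReal w), rdet_add, rdet_add, rdet_self, rdet_self,
    rdet_swap (toReal v) (toReal w), rdet_toReal]
  constructor <;> simpa using hd

/-! ### Fans determined by their rays -/

/-- Two vectors of `R` span a cone of the fan with rays through `R` if they form a positively
oriented pair and no other vector of `R` lies strictly between them. -/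
def Adjacent (R : Set N) (v w : N) : Prop :=
  v ∈ R ∧ w ∈ R ∧ 0 < det v w ∧ ∀ u ∈ R, 0 < det v u → ¬ 0 < det u w

/-- The cones of the fan with rays through `R`. -/
inductive FanCone (R : Set N) : PointedCone ℝ NReal → Prop
  | bot : FanCone R ⊥
  | ray (v : N) (hv : v ∈ R) : FanCone R (latticeCone {v})
  | pair (v w : N) (h : Adjacent R v w) : FanCone R (latticeCone {v, w})

lemma not_inRelint_zero_ray {v : N} (hv : IsCoprime (v 0) (v 1)) :
    ¬ InRelint 0 (latticeCone {v}) := fun h => by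
  obtain ⟨a, ha, h0⟩ := inRelint_ray hv h
  exact (smul_ne_zero ha.ne' (toReal_ne_zero (ne_zero_of_isCoprime hv))) h0.symm

lemma not_inRelint_zero_pair {v w : N} (h : 0 < det v w) :
    ¬ InRelint 0 (latticeCone {v, w}) := fun h0 => by
  have := ((inRelint_pair_iff h).1 h0).1
  simp at this

lemma not_inRelint_ray_pair {u v w : N} (hu : IsCoprime (u 0) (u 1)) (hd : 0 < det v w)
    (h : 0 < det v u → ¬ 0 < det u w) {z : NReal} (h1 : InRelint z (latticeCone {u}))
    (h2 : InRelint z (latticeCone {v, w})) : False := by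
  obtain ⟨a, ha, rfl⟩ := inRelint_ray hu h1
  rw [inRelint_pair_iff hd, rdet_smul, rdet_swap (toReal w), rdet_smul, ← mul_neg,
    ← rdet_swap, rdet_toReal, rdet_toReal] at h2
  exact h (by exact_mod_cast pos_of_mul_pos_right h2.1 ha.le)
    (by exact_mod_cast pos_of_mul_pos_right h2.2 ha.le)

/-- The Plücker relation. -/
lemma rdet_pluecker (a v w z : NReal) :
    rdet v w * rdet a z = rdet a w * rdet v z + rdet v a * rdet w z := by
  simp [rdet]; ring

/-- If `v'` were strictly to the left of `v`, adjacency would give `det v' w ≤ 0`, and the two sides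
of the Plücker relation at `z` would have opposite signs. Used in both directions, it makes the
first edges of overlapping cones parallel. -/
lemma det_nonpos_left {R : Set N} {v w v' w' : N} (h : Adjacent R v w) (h' : Adjacent R v' w')
    {z : NReal} (h1 : InRelint z (latticeCone {v, w})) (h2 : InRelint z (latticeCone {v', w'})) :
    det v v' ≤ 0 := by
  by_contra! hc
  have h3 : det v' w ≤ 0 := not_lt.1 (h.2.2.2 v' h'.1 hc)
  have h1 := (inRelint_pair_iff h.2.2.1).1 h1
  have h2 := ((inRelint_pair_iff h'.2.2.1).1 h2).1
  have key := rdet_pluecker (toReal v') (toReal v) (toReal w) z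
  rw [rdet_swap z (toReal w)] at key
  simp only [rdet_toReal] at key
  have hd : (0 : ℝ) < det v w := by exact_mod_cast h.2.2.1
  have hc' : (0 : ℝ) < det v v' := by exact_mod_cast hc
  have h3' : (det v' w : ℝ) ≤ 0 := by exact_mod_cast h3
  have := mul_pos hd h2
  have := mul_pos hc' h1.2
  have := mul_nonneg_of_nonpos_of_nonpos h3' (neg_nonpos.2 h1.1.le)
  linarith

lemma det_nonpos_right {R : Set N} {v w v' w' : N} (h : Adjacent R v w) (h' : Adjacent R v' w')
    {z : NReal} (h1 : InRelint z (latticeCone {v, w})) (h2 : InRelint z (latticeCone {v', w'})) :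
    det w' w ≤ 0 := by
  by_contra! hc
  have h3 : det v w' ≤ 0 := not_lt.1 fun h4 => h.2.2.2 w' h'.2.1 h4 hc
  have h1 := (inRelint_pair_iff h.2.2.1).1 h1
  have h2 := ((inRelint_pair_iff h'.2.2.1).1 h2).2
  have key := rdet_pluecker (toReal w') (toReal v) (toReal w) z
  rw [rdet_swap z (toReal w), rdet_swap z (toReal w')] at key
  simp only [rdet_toReal] at key
  have hd : (0 : ℝ) < det v w := by exact_mod_cast h.2.2.1
  have hc' : (0 : ℝ) < det w' w := by exact_mod_cast hc
  have h3' : (det v w' : ℝ) ≤ 0 := by exact_mod_cast h3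
  have := mul_pos hd h2
  have := mul_pos hc' h1.1
  have := mul_nonneg_of_nonpos_of_nonpos h3' (neg_nonpos.2 h1.2.le)
  linarith

lemma eq_of_det_eq_zero {v v' : N} (hv : IsCoprime (v 0) (v 1)) (hv' : IsCoprime (v' 0) (v' 1))
    {z : NReal} (h : det v v' = 0) (h1 : 0 < rdet (toReal v) z) (h2 : 0 < rdet (toReal v') z) :
    v = v' := by
  have hx : rdet (toReal v') z • toReal v = rdet (toReal v) z • toReal v' := by
    have := rdet_smul_eq z (toReal v') (toReal v)
    rw [rdet_toReal, h, Int.cast_zero, zero_smul, zero_add, rdet_swap, neg_smul,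
      rdet_swap (toReal v) z, neg_smul] at this
    exact neg_injective this
  exact eq_of_smul_eq_smul hv hv' h2 h1 hx

/-- The relative interiors of the cones of the fan with rays through `R` are disjoint. -/
theorem FanCone.eq_of_inRelint {R : Set N} (hR : ∀ v ∈ R, IsCoprime (v 0) (v 1))
    {σ τ : PointedCone ℝ NReal} (hσ : FanCone R σ) (hτ : FanCone R τ) {z : NReal}
    (h1 : InRelint z σ) (h2 : InRelint z τ) : σ = τ := by
  cases hσ with
  | bot =>
    obtain rfl := inRelint_bot h1
    cases hτ with
    | bot => rfl
    | ray v hv => exact absurd h2 (not_inRelint_zero_ray (hR v hv))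
    | pair v w h => exact absurd h2 (not_inRelint_zero_pair h.2.2.1)
  | ray v hv =>
    cases hτ with
    | bot =>
      obtain rfl := inRelint_bot h2
      exact absurd h1 (not_inRelint_zero_ray (hR v hv))
    | ray u hu =>
      obtain ⟨a, ha, rfl⟩ := inRelint_ray (hR v hv) h1
      obtain ⟨b, hb, h3⟩ := inRelint_ray (hR u hu) h2
      rw [eq_of_smul_eq_smul (hR v hv) (hR u hu) ha hb h3]
    | pair u w h => exact (not_inRelint_ray_pair (hR v hv) h.2.2.1 (h.2.2.2 v hv) h1 h2).elim
  | pair v w h =>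
    cases hτ with
    | bot =>
      obtain rfl := inRelint_bot h2
      exact absurd h1 (not_inRelint_zero_pair h.2.2.1)
    | ray u hu => exact (not_inRelint_ray_pair (hR u hu) h.2.2.1 (h.2.2.2 u hu) h2 h1).elim
    | pair v' w' h' =>
      have e1 : det v v' = 0 := by
        have a := det_nonpos_left h h' h1 h2
        have b := det_nonpos_left h' h h2 h1
        rw [det_swap] at b
        omega
      have e2 : det w w' = 0 := by
        have a := det_nonpos_right h h' h1 h2
        have b := det_nonpos_right h' h h2 h1
        rw [det_swap] at a
        omega
      have h1' := (inRelint_pair_iff h.2.2.1).1 h1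
      have h2' := (inRelint_pair_iff h'.2.2.1).1 h2
      -- The second edges see `z` on their other side, so the same lemma applies to them with `-z`.
      rw [eq_of_det_eq_zero (hR v h.1) (hR v' h'.1) e1 h1'.1 h2'.1,
        eq_of_det_eq_zero (z := -z) (hR w h.2.1) (hR w' h'.2.1) e2
          (by rw [rdet_neg_right, ← rdet_swap]; exact h1'.2)
          (by rw [rdet_neg_right, ← rdet_swap]; exact h2'.2)]

lemma FanCone.isStandardCone {R : Set N} (hR : ∀ v ∈ R, IsCoprime (v 0) (v 1))
    {σ : PointedCone ℝ NReal} (hσ : FanCone R σ) : IsStandardCone σ := by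
  cases hσ with
  | bot => exact .bot
  | ray v hv => exact .ray v (hR v hv)
  | pair v w h => exact .pair v w (hR v h.1) (hR w h.2.1) h.2.2.1

lemma FanCone.of_isFaceOf {R : Set N} {σ τ : PointedCone ℝ NReal} (hσ : FanCone R σ)
    (h : τ.IsFaceOf σ) : FanCone R τ := by
  cases hσ with
  | bot =>
    rw [le_bot_iff.1 h.le]
    exact .bot
  | ray v hv =>
    rcases eq_bot_or_eq_of_isFaceOf_singleton h with rfl | rfl
    · exact .bot
    · exact .ray v hv
  | pair v w hvw =>
    rcases eq_of_isFaceOf_pair h with rfl | rfl | rfl | rfl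
    · exact .bot
    · exact .ray v hvw.1
    · exact .ray w hvw.2.1
    · exact .pair v w hvw

/-- The smallest faces of `σ` and of `τ` through a common point coincide, since relative interiors
are disjoint. This common face contains every summand from `σ` and lies in `τ`. -/
lemma FanCone.inf_isFaceOf {R : Set N} (hR : ∀ v ∈ R, IsCoprime (v 0) (v 1))
    {σ τ : PointedCone ℝ NReal} (hσ : FanCone R σ) (hτ : FanCone R τ) : (σ ⊓ τ).IsFaceOf σ where
  le := inf_le_left
  mem_of_smul_add_mem := by
    intro x y a hx hy ha hz
    refine ⟨hx, ?_⟩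
    obtain ⟨σ', hσ', hzσ'⟩ := exists_isFaceOf_inRelint hz.1
    obtain ⟨τ', hτ', hzτ'⟩ := exists_isFaceOf_inRelint hz.2
    obtain rfl := (hσ.of_isFaceOf hσ').eq_of_inRelint hR (hτ.of_isFaceOf hτ') hzσ' hzτ'
    exact hτ'.le (hσ'.mem_of_smul_add_mem hx hy ha hzσ'.1)

/-- The fan with rays through a finite set `R` of primitive vectors, containing all cones spanned
by adjacent vectors. -/
def Fan.ofRays (R : Set N) (hfin : R.Finite) (hR : ∀ v ∈ R, IsCoprime (v 0) (v 1)) : Fan where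
  cones := {σ | FanCone R σ}
  finite := by
    refine ((((Set.finite_singleton ∅).union (hfin.image fun v => ({v} : Set N))).union
      ((hfin.prod hfin).image fun p => ({p.1, p.2} : Set N))).image latticeCone).subset ?_
    rintro σ (_ | ⟨v, hv⟩ | ⟨v, w, h⟩)
    · exact ⟨∅, by simp, latticeCone_empty⟩
    · exact ⟨{v}, Or.inl (Or.inr ⟨v, hv, rfl⟩), rfl⟩
    · exact ⟨{v, w}, Or.inr ⟨(v, w), ⟨h.1, h.2.1⟩, rfl⟩, rfl⟩
  rational := by
    rintro σ (_ | ⟨v, hv⟩ | ⟨v, w, h⟩)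
    · exact ⟨∅, Set.finite_empty, latticeCone_empty.symm⟩
    · exact ⟨{v}, Set.finite_singleton v, rfl⟩
    · exact ⟨{v, w}, Set.toFinite _, rfl⟩
  stronglyConvex := fun σ hσ => (FanCone.isStandardCone hR hσ).salient
  face_mem := fun σ hσ τ hτ => FanCone.of_isFaceOf hσ hτ
  inf_isFaceOf := fun σ hσ τ hτ => ⟨FanCone.inf_isFaceOf hR hσ hτ, by
    rw [inf_comm]
    exact FanCone.inf_isFaceOf hR hτ hσ⟩

lemma latticeCone_singleton_ne_bot {v : N} (hv : IsCoprime (v 0) (v 1)) : latticeCone {v} ≠ ⊥ :=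
  fun h => toReal_ne_zero (ne_zero_of_isCoprime hv)
    (show toReal v ∈ (⊥ : PointedCone ℝ NReal) from h ▸ toReal_mem_latticeCone rfl)

lemma latticeCone_singleton_ne_pair {u v w : N} (h : 0 < det v w) :
    latticeCone {u} ≠ latticeCone {v, w} := fun he => by
  have hv : toReal v ∈ latticeCone {u} := he ▸ toReal_mem_latticeCone (by simp)
  have hw : toReal w ∈ latticeCone {u} := he ▸ toReal_mem_latticeCone (by simp)
  obtain ⟨a, -, ha⟩ := mem_latticeCone_singleton.1 hv
  obtain ⟨b, -, hb⟩ := mem_latticeCone_singleton.1 hw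
  apply rdet_toReal_ne_zero h
  rw [ha, hb, rdet_smul, rdet_swap, rdet_smul, rdet_self]
  simp

lemma Fan.rayGenerators_ofRays (R : Set N) (hfin : R.Finite)
    (hR : ∀ v ∈ R, IsCoprime (v 0) (v 1)) : (Fan.ofRays R hfin hR).rayGenerators = R := by
  ext u
  refine ⟨?_, fun hu => ⟨hR u hu, .ray u hu⟩⟩
  rintro ⟨hu, h : FanCone R _⟩
  generalize hσ : latticeCone {u} = σ at h
  cases h with
  | bot => exact absurd hσ (latticeCone_singleton_ne_bot hu)
  | ray v hv => rwa [latticeCone_singleton_injective hu (hR v hv) hσ]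
  | pair v w h => exact absurd hσ (latticeCone_singleton_ne_pair h.2.2.1)

/-! ### Complete fans, their rays and their subdivisions -/

lemma Fan.isCoprime_of_mem_rayGenerators (Δ : Fan) :
    ∀ v ∈ Δ.rayGenerators, IsCoprime (v 0) (v 1) := fun _ h => h.1

lemma Fan.fanCone_of_mem (Δ : Fan) {σ : PointedCone ℝ NReal} (hσ : σ ∈ Δ.cones) :
    FanCone Δ.rayGenerators σ := by
  have hst := Δ.isStandardCone hσ
  cases hst with
  | bot => exact .bot
  | ray v hv => exact .ray v ⟨hv, hσ⟩
  | pair v w hv hw h =>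
    refine .pair v w ⟨⟨hv, Δ.face_mem _ hσ _ (isFaceOf_left h)⟩,
      ⟨hw, Δ.face_mem _ hσ _ (isFaceOf_right h)⟩, h, fun u hu h1 h2 => ?_⟩
    -- A ray through the interior would meet the cone in a face containing an interior point, so the
    -- whole cone would lie in that ray.
    have hint : InRelint (toReal u) (latticeCone {v, w}) := by
      rw [inRelint_pair_iff h, rdet_toReal, rdet_toReal]
      exact ⟨by exact_mod_cast h1, by exact_mod_cast h2⟩
    have hface := (Δ.inf_isFaceOf _ hσ _ hu.2).1
    have hle := inf_eq_left.1 (hint.2 _ hface ⟨hint.1, toReal_mem_latticeCone rfl⟩)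
    have hle' : latticeCone {u} ≤ latticeCone {v, w} :=
      latticeCone_le.2 (by rintro _ rfl; exact hint.1)
    exact latticeCone_singleton_ne_pair h (le_antisymm hle' hle)

lemma Fan.IsComplete.exists_inRelint {Δ : Fan} (hΔ : Δ.IsComplete) (z : NReal) :
    ∃ τ ∈ Δ.cones, InRelint z τ := by
  obtain ⟨τ, hτ, hz⟩ : z ∈ Δ.support := hΔ ▸ Set.mem_univ z
  obtain ⟨τ', hτ', hz'⟩ := exists_isFaceOf_inRelint hz
  exact ⟨τ', Δ.face_mem _ hτ _ hτ', hz'⟩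

/-- The cones of a complete fan are determined by its rays. -/
theorem Fan.IsComplete.mem_cones_iff {Δ : Fan} (hΔ : Δ.IsComplete) (σ : PointedCone ℝ NReal) :
    σ ∈ Δ.cones ↔ FanCone Δ.rayGenerators σ := by
  refine ⟨Δ.fanCone_of_mem, fun hσ => ?_⟩
  -- Completeness puts `z` in the relative interior of some cone of `Δ`, which disjointness
  -- identifies with `σ`.
  have hex : ∃ z, InRelint z σ := by
    cases hσ with
    | bot => exact ⟨0, exists_isFaceOf_inRelint (zero_mem ⊥) |>.elim fun τ h =>
        (le_bot_iff.1 h.1.le) ▸ h.2⟩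
    | ray v hv =>
      refine ⟨toReal v, toReal_mem_latticeCone rfl, fun τ hτ h => ?_⟩
      rcases eq_bot_or_eq_of_isFaceOf_singleton hτ with rfl | rfl
      · exact absurd h (toReal_ne_zero (ne_zero_of_isCoprime hv.1))
      · rfl
    | pair v w h => exact ⟨_, inRelint_add h.2.2.1⟩
  obtain ⟨z, hz⟩ := hex
  obtain ⟨τ, hτ, hzτ⟩ := hΔ.exists_inRelint z
  rwa [hσ.eq_of_inRelint Δ.isCoprime_of_mem_rayGenerators (Δ.fanCone_of_mem hτ) hz hzτ]

theorem Fan.IsComplete.ext_rayGenerators {Δ Δ' : Fan} (hΔ : Δ.IsComplete) (hΔ' : Δ'.IsComplete)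
    (h : Δ.rayGenerators = Δ'.rayGenerators) : Δ = Δ' := by
  ext σ
  rw [hΔ.mem_cones_iff, hΔ'.mem_cones_iff, h]

/-- A two-dimensional cone without rays of a complete fan in its interior lies in a cone of the
fan. -/
theorem Fan.IsComplete.exists_le {Δ : Fan} (hΔ : Δ.IsComplete) {v w : N} (hd : 0 < det v w)
    (h : ∀ u ∈ Δ.rayGenerators, 0 < det v u → ¬ 0 < det u w) :
    ∃ τ ∈ Δ.cones, latticeCone {v, w} ≤ τ := by
  -- The interior point `v + w` selects the only possible `τ`.
  obtain ⟨τ, hτ, hz⟩ := hΔ.exists_inRelint (toReal v + toReal w)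
  refine ⟨τ, hτ, ?_⟩
  have hadd := inRelint_add hd
  cases Δ.fanCone_of_mem hτ with
  | bot =>
    rw [inRelint_bot hz] at hadd
    exact absurd hadd (not_inRelint_zero_pair hd)
  | ray u hu => exact (not_inRelint_ray_pair hu.1 hd (h u hu) hz hadd).elim
  | pair a b hab =>
    have hz' := (inRelint_pair_iff hab.2.2.1).1 hz
    rw [rdet_swap (toReal b), rdet_add, rdet_add, neg_add, ← rdet_swap, ← rdet_swap] at hz'
    simp only [rdet_toReal] at hz'
    have h1 : 0 < det a v + det a w := by exact_mod_cast hz'.1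
    have h2 : 0 < det v b + det w b := by exact_mod_cast hz'.2
    have h3 := h a hab.1
    have h4 := h b hab.2.1
    -- With `p = det a w`, `q = det v a`, `r = det b w`, `s = det v b` this says `p s > q r`. As
    -- neither `a` nor `b` is interior to `⟨v, w⟩`, `q` and `r` are nonpositive. The inequalities `p
    -- > q` and `s > r` then force `p` and `s` to be nonnegative.
    have h5 : 0 < det a w * det v b - det v a * det b w := by
      have : det a w * det v b - det v a * det b w = det v w * det a b := by
        simp only [det]; ring
      rw [this]
      exact mul_pos hd hab.2.2.1
    rw [det_swap v a] at h1
    rw [det_swap b w] at h2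
    have hq : det v a ≤ 0 := by
      by_contra! hc
      have := h3 hc
      omega
    have hr : det b w ≤ 0 := by
      by_contra! hc
      have : ¬ 0 < det v b := fun hs => h4 hs hc
      omega
    have hs : 0 ≤ det v b := by
      by_contra! hc
      have hp : det a w < 0 := by nlinarith
      nlinarith
    have hp : 0 ≤ det a w := by
      by_contra! hc
      nlinarith
    refine latticeCone_le.2 ?_
    rintro _ (rfl | rfl) <;> rw [toReal_mem_latticeCone_pair_iff hab.2.2.1]
    · exact ⟨by rw [det_swap]; omega, hs⟩
    · exact ⟨hp, by rw [det_swap]; omega⟩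

lemma Fan.IsComplete.mapsTo_of_pairs {Δ Δ' : Fan} (hΔ : Δ.IsComplete)
    (h : ∀ v w, Adjacent Δ'.rayGenerators v w → latticeCone {v, w} ∈ Δ'.cones →
      ∀ u ∈ Δ.rayGenerators, 0 < det v u → ¬ 0 < det u w) : Δ'.MapsTo Δ := by
  intro σ hσ
  cases Δ'.fanCone_of_mem hσ with
  | bot =>
    obtain ⟨τ, hτ, -⟩ : (0 : NReal) ∈ Δ.support := hΔ ▸ Set.mem_univ 0
    exact ⟨τ, hτ, bot_le⟩
  | ray v hv =>
    obtain ⟨τ, hτ, hv'⟩ : toReal v ∈ Δ.support := hΔ ▸ Set.mem_univ _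
    exact ⟨τ, hτ, latticeCone_le.2 (by rintro _ rfl; exact hv')⟩
  | pair v w hvw => exact hΔ.exists_le hvw.2.2.1 (h v w hvw hσ)

lemma Fan.IsComplete.isSubdivision {Δ Δ' : Fan} (hΔ : Δ.IsComplete) (hΔ' : Δ'.IsComplete)
    (h : Δ.rayGenerators ⊆ Δ'.rayGenerators) : Δ'.IsSubdivision Δ :=
  ⟨hΔ.mapsTo_of_pairs fun _ _ hvw _ u hu => hvw.2.2.2 u (h hu), hΔ'.trans hΔ.symm⟩

lemma Fan.isComplete_ofRays {R : Set N} (hfin : R.Finite) (hR : ∀ v ∈ R, IsCoprime (v 0) (v 1))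
    (h : ∀ x : NReal, ∃ v w, Adjacent R v w ∧ 0 ≤ rdet (toReal v) x ∧ 0 ≤ rdet x (toReal w)) :
    (Fan.ofRays R hfin hR).IsComplete := by
  refine Set.eq_univ_of_forall fun x => ?_
  obtain ⟨v, w, hvw, hx⟩ := h x
  exact ⟨_, .pair v w hvw, (mem_latticeCone_pair_iff hvw.2.2.1).2 hx⟩

/-! ### Antisymmetry of refinement -/

theorem Fan.cones_subset_of_mapsTo {Δ Δ' : Fan} (h : Δ.MapsTo Δ') (h' : Δ'.MapsTo Δ) :
    Δ.cones ⊆ Δ'.cones := by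
  intro σ hσ
  -- A maximal cone is squeezed, `μ ≤ τ ≤ ρ` with `ρ` in `Δ`, so it belongs to `Δ'`; the cone `σ` is
  -- one of its faces.
  obtain ⟨μ, hσμ, hμ⟩ := Δ.finite.exists_le_maximal hσ
  obtain ⟨τ, hτ, hμτ⟩ := h μ hμ.1
  obtain ⟨ρ, hρ, hτρ⟩ := h' τ hτ
  obtain rfl : μ = τ := le_antisymm hμτ (hτρ.trans (hμ.2 hρ (hμτ.trans hτρ)))
  have := (Δ.inf_isFaceOf _ hσ _ hμ.1).2
  rw [inf_eq_left.2 hσμ] at this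
  exact Δ'.face_mem _ hτ _ this

theorem Fan.mapsTo_antisymm {Δ Δ' : Fan} (h : Δ.MapsTo Δ') (h' : Δ'.MapsTo Δ) : Δ = Δ' := by
  ext σ
  exact ⟨fun hσ => cones_subset_of_mapsTo h h' hσ, fun hσ => cones_subset_of_mapsTo h' h hσ⟩

theorem Fan.IsMinimalDesingularization.unique {Δ D D' : Fan} (h : D.IsMinimalDesingularization Δ)
    (h' : D'.IsMinimalDesingularization Δ) : D = D' :=
  Fan.mapsTo_antisymm (h'.2 D h.1) (h.2 D' h'.1)

/-! ### Smoothness of monoid algebras -/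

/-- An additive monoid whose homomorphisms to quotients by square-zero ideals lift. -/
def HasInfinitesimalLifting (P : Type) [AddCommMonoid P] : Prop :=
  ∀ (B : Type) [CommRing B] (I : Ideal B), I ^ 2 = ⊥ → ∀ φ : Multiplicative P →* B ⧸ I,
    ∃ ψ : Multiplicative P →* B, ∀ p, Ideal.Quotient.mk I (ψ p) = φ p

lemma hasInfinitesimalLifting_nat : HasInfinitesimalLifting ℕ := by
  intro B _ I _ φ
  obtain ⟨b, hb⟩ := Ideal.Quotient.mk_surjective (φ (Multiplicative.ofAdd 1))
  refine ⟨powersHom B b, fun p => ?_⟩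
  rw [powersHom_apply, map_pow, hb, ← map_pow, ← ofAdd_nsmul]
  simp

/-- For a lift `c` of the inverse, `b c - 1` squares to zero, so `b c` is a unit. -/
lemma isUnit_of_isUnit_mk {B : Type} [CommRing B] {I : Ideal B} (hI : I ^ 2 = ⊥) {b : B}
    (hb : IsUnit (Ideal.Quotient.mk I b)) : IsUnit b := by
  obtain ⟨c, hc⟩ := hb.exists_right_inv
  obtain ⟨c, rfl⟩ := Ideal.Quotient.mk_surjective c
  rw [← map_mul, ← map_one (Ideal.Quotient.mk I), Ideal.Quotient.eq] at hc
  have hn : IsNilpotent (b * c - 1) := ⟨2, by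
    have := Ideal.pow_mem_pow hc 2
    rwa [hI, Ideal.mem_bot] at this⟩
  have := hn.isUnit_add_one
  rw [sub_add_cancel] at this
  exact isUnit_of_mul_isUnit_left this

lemma hasInfinitesimalLifting_int : HasInfinitesimalLifting ℤ := by
  intro B _ I hI φ
  obtain ⟨b, hb⟩ := Ideal.Quotient.mk_surjective (φ (Multiplicative.ofAdd 1))
  have hu : IsUnit (φ (Multiplicative.ofAdd 1)) := (Group.isUnit _).map φ
  rw [← hb] at hu
  obtain ⟨u, rfl⟩ := isUnit_of_isUnit_mk hI hu
  set ψ : Multiplicative ℤ →* B := (Units.coeHom B).comp (zpowersHom Bˣ u) with hψ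
  have h : ((Ideal.Quotient.mk I : B →+* B ⧸ I) : B →* B ⧸ I).comp ψ = φ := by
    apply MonoidHom.ext_mint
    simp [hψ, hb]
  exact ⟨ψ, fun p => DFunLike.congr_fun h p⟩

lemma HasInfinitesimalLifting.prod {P Q : Type} [AddCommMonoid P] [AddCommMonoid Q]
    (hP : HasInfinitesimalLifting P) (hQ : HasInfinitesimalLifting Q) :
    HasInfinitesimalLifting (P × Q) := by
  intro B _ I hI φ
  obtain ⟨f, hf⟩ := hP B I hI (φ.comp (AddMonoidHom.toMultiplicative (AddMonoidHom.inl P Q)))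
  obtain ⟨g, hg⟩ := hQ B I hI (φ.comp (AddMonoidHom.toMultiplicative (AddMonoidHom.inr P Q)))
  refine ⟨f.comp (AddMonoidHom.toMultiplicative (AddMonoidHom.fst P Q)) *
    g.comp (AddMonoidHom.toMultiplicative (AddMonoidHom.snd P Q)), fun p => ?_⟩
  rw [MonoidHom.mul_apply, map_mul, MonoidHom.comp_apply, MonoidHom.comp_apply, hf, hg,
    MonoidHom.comp_apply, MonoidHom.comp_apply, ← map_mul]
  congr 1
  apply Multiplicative.toAdd.injective
  simp

lemma HasInfinitesimalLifting.of_equiv {P Q : Type} [AddCommMonoid P] [AddCommMonoid Q]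
    (hP : HasInfinitesimalLifting P) (e : P ≃+ Q) : HasInfinitesimalLifting Q := by
  intro B _ I hI φ
  obtain ⟨ψ, hψ⟩ := hP B I hI (φ.comp (AddMonoidHom.toMultiplicative e.toAddMonoidHom))
  refine ⟨ψ.comp (AddMonoidHom.toMultiplicative e.symm.toAddMonoidHom), fun p => ?_⟩
  rw [MonoidHom.comp_apply, hψ, MonoidHom.comp_apply]
  congr 1
  apply Multiplicative.toAdd.injective
  simp

/-- Algebra maps out of the monoid algebra are monoid homomorphisms out of `P`, so the lifting
property is formal smoothness; finite presentation follows from finite type over a field. -/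
theorem HasInfinitesimalLifting.smooth {P : Type} [AddCommMonoid P] [AddMonoid.FG P]
    (hP : HasInfinitesimalLifting P) : Algebra.Smooth ℂ (AddMonoidAlgebra ℂ P) where
  finitePresentation := Algebra.FinitePresentation.of_finiteType.1 inferInstance
  formallySmooth := by
    refine Algebra.FormallySmooth.of_comp_surjective fun B _ _ I hI f => ?_
    obtain ⟨ψ, hψ⟩ := hP B I hI ((AddMonoidAlgebra.lift ℂ (B ⧸ I) P).symm f)
    refine ⟨AddMonoidAlgebra.lift ℂ B P ψ, ?_⟩
    apply (AddMonoidAlgebra.lift ℂ (B ⧸ I) P).symm.injective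
    refine MonoidHom.ext fun p => ?_
    rw [← hψ]
    simp [AddMonoidAlgebra.lift_symm_apply]

/-! ### Dual monoids -/

/-- The pairing of `M` and `N`. -/
def pairing (v : N) : M →+ ℤ where
  toFun m := m 0 * v 0 + m 1 * v 1
  map_zero' := by simp
  map_add' := by intros; simp; ring

lemma pairing_apply (v : N) (m : M) : pairing v m = m 0 * v 0 + m 1 * v 1 := rfl

lemma mem_dualMonoid_latticeCone {S : Set N} {m : M} :
    m ∈ dualMonoid (latticeCone S) ↔ ∀ v ∈ S, 0 ≤ pairing v m := by
  have hcast : ∀ v : N, ∑ i, (m i : ℝ) * toReal v i = (pairing v m : ℝ) := by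
    intro v
    simp [pairing_apply]
  constructor
  · intro h v hv
    have := h _ (toReal_mem_latticeCone hv)
    rw [hcast] at this
    exact_mod_cast this
  · intro h x hx
    induction hx using Submodule.span_induction with
    | mem x hx =>
      obtain ⟨v, hv, rfl⟩ := hx
      rw [hcast]
      exact_mod_cast h v hv
    | zero => simp
    | add x y _ _ hx hy =>
      simp only [Pi.add_apply, mul_add, Finset.sum_add_distrib]
      exact add_nonneg hx hy
    | smul a x _ hx =>
      have : ∑ i, (m i : ℝ) * (a • x) i = a * ∑ i, (m i : ℝ) * x i := by
        rw [Finset.mul_sum]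
        refine Finset.sum_congr rfl fun i _ => ?_
        change (m i : ℝ) * (a * x i) = _
        ring
      rw [this]
      exact mul_nonneg a.2 hx

/-- For a lattice basis `v`, `w` the two pairings are coordinates on `M`, with inverse given by
Cramer's rule. Taking `ℕ` or `ℤ` for `P` and `Q` covers constrained and free coordinates, hence
cones of every dimension. -/
lemma exists_equiv_dualMonoid {v w : N} (hd : det v w = 1) {P Q : Type} [AddCommMonoid P]
    [AddCommMonoid Q] (i : P →+ ℤ) (j : Q →+ ℤ) (hi : Function.Injective i)
    (hj : Function.Injective j) {S : AddSubmonoid M}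
    (hS : ∀ m, m ∈ S ↔ pairing v m ∈ Set.range i ∧ pairing w m ∈ Set.range j) :
    Nonempty (P × Q ≃+ S) := by
  let f : P × Q →+ M :=
    { toFun := fun p => ![i p.1 * w 1 - j p.2 * v 1, j p.2 * v 0 - i p.1 * w 0]
      map_zero' := by ext k; fin_cases k <;> simp
      map_add' := by intro p q; ext k; fin_cases k <;> simp <;> ring }
  simp only [det] at hd
  have h1 : ∀ p, pairing v (f p) = i p.1 := fun p => by
    simp only [pairing_apply, f, AddMonoidHom.coe_mk, ZeroHom.coe_mk, Matrix.cons_val_zero,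
      Matrix.cons_val_one]
    linear_combination i p.1 * hd
  have h2 : ∀ p, pairing w (f p) = j p.2 := fun p => by
    simp only [pairing_apply, f, AddMonoidHom.coe_mk, ZeroHom.coe_mk, Matrix.cons_val_zero,
      Matrix.cons_val_one]
    linear_combination j p.2 * hd
  have hf : ∀ p, f p ∈ S := fun p => (hS _).2 ⟨⟨p.1, (h1 p).symm⟩, ⟨p.2, (h2 p).symm⟩⟩
  refine ⟨AddEquiv.ofBijective (f.codRestrict S hf) ⟨fun p q hpq => ?_, fun m => ?_⟩⟩
  · have h : f p = f q := congrArg Subtype.val hpq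
    exact Prod.ext (hi (by rw [← h1, h, h1])) (hj (by rw [← h2, h, h2]))
  · obtain ⟨⟨p, hp⟩, ⟨q, hq⟩⟩ := (hS m).1 m.2
    refine ⟨(p, q), Subtype.ext ?_⟩
    rw [pairing_apply] at hp hq
    ext k
    fin_cases k
    · change i p * w 1 - j q * v 1 = m.1 0
      rw [hp, hq]
      linear_combination (m.1 0) * hd
    · change j q * v 0 - i p * w 0 = m.1 1
      rw [hp, hq]
      linear_combination (m.1 1) * hd

lemma mem_range_natCast {z : ℤ} : z ∈ Set.range (Nat.castAddMonoidHom ℤ) ↔ 0 ≤ z := by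
  constructor
  · rintro ⟨n, rfl⟩
    simp
  · intro h
    exact ⟨z.toNat, by simpa using h⟩

lemma smooth_of_equiv {P Q : Type} [AddCommMonoid P] [AddCommMonoid Q] [AddMonoid.FG P]
    [AddMonoid.FG Q] (hP : HasInfinitesimalLifting P) (hQ : HasInfinitesimalLifting Q)
    {S : AddSubmonoid M} (h : Nonempty (P × Q ≃+ S)) :
    Algebra.Smooth ℂ (AddMonoidAlgebra ℂ S) := by
  obtain ⟨e⟩ := h
  have : AddMonoid.FG S := AddMonoid.fg_of_surjective e.toAddMonoidHom e.surjective
  exact ((hP.prod hQ).of_equiv e).smooth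

lemma smooth_latticeCone_pair {v w : N} (hd : det v w = 1) :
    Algebra.Smooth ℂ (coordinateRing (latticeCone {v, w})) := by
  refine smooth_of_equiv hasInfinitesimalLifting_nat hasInfinitesimalLifting_nat
    (exists_equiv_dualMonoid hd (Nat.castAddMonoidHom ℤ) (Nat.castAddMonoidHom ℤ)
      Nat.cast_injective Nat.cast_injective fun m => ?_)
  rw [mem_dualMonoid_latticeCone, mem_range_natCast, mem_range_natCast]
  simp

lemma smooth_latticeCone_singleton {v : N} (hv : IsCoprime (v 0) (v 1)) :
    Algebra.Smooth ℂ (coordinateRing (latticeCone {v})) := by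
  obtain ⟨a, b, hab⟩ := hv
  -- The Bézout coefficients complete `v` to a basis.
  have hd : det v ![-b, a] = 1 := by
    simp [det]
    linarith
  refine smooth_of_equiv hasInfinitesimalLifting_nat hasInfinitesimalLifting_int
    (exists_equiv_dualMonoid hd (Nat.castAddMonoidHom ℤ) (AddMonoidHom.id ℤ)
      Nat.cast_injective Function.injective_id fun m => ?_)
  rw [mem_dualMonoid_latticeCone, mem_range_natCast]
  simp

lemma smooth_bot : Algebra.Smooth ℂ (coordinateRing ⊥) := by
  have hd : det ![1, 0] ![0, 1] = 1 := by simp [det]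
  refine smooth_of_equiv hasInfinitesimalLifting_int hasInfinitesimalLifting_int
    (exists_equiv_dualMonoid hd (AddMonoidHom.id ℤ) (AddMonoidHom.id ℤ)
      Function.injective_id Function.injective_id fun m => ?_)
  rw [← latticeCone_empty, mem_dualMonoid_latticeCone]
  simp

/-! ### Singular cones -/

open Polynomial in
-- Compare orders at 0: `E F ^ q` vanishes to order exactly `q + 1`, but `G ^ d` to order at least
-- `2 d ≥ q + 2`.
lemma not_X_pow_dvd {d q : ℕ} (hdq : q + 2 ≤ 2 * d) {E F G : ℂ[X]} (hE : X ^ 2 ∣ E - X)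
    (hF : X ^ 2 ∣ F - X) (hG : X ^ 2 ∣ G) : ¬ X ^ (q + 2) ∣ G ^ d - E * F ^ q := by
  intro h
  obtain ⟨a, ha⟩ := hE
  obtain ⟨b, hb⟩ := hF
  obtain ⟨c, rfl⟩ := hG
  have h1 : (X : ℂ[X]) ^ (q + 2) ∣ (X ^ 2 * c) ^ d := by
    rw [mul_pow, ← pow_mul]
    exact (pow_dvd_pow X hdq).mul_right _
  have h2 := (dvd_sub_right h1).1 h
  have h3 : E * F ^ q = X ^ (q + 1) * ((1 + X * a) * (1 + X * b) ^ q) := by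
    have hE : E = X * (1 + X * a) := by linear_combination ha
    have hF : F = X * (1 + X * b) := by linear_combination hb
    rw [hE, hF, mul_pow]
    ring
  rw [h3, pow_succ _ (q + 1), mul_dvd_mul_iff_left (pow_ne_zero _ X_ne_zero), X_dvd_iff,
    coeff_zero_eq_eval_zero] at h2
  simp at h2

open Polynomial in
/-- A tangent vector at the closed orbit which does not extend to an arc obstructs smoothness. -/
theorem not_formallySmooth_of_relation {S : Type} [AddCommMonoid S]
    (hS : ∀ s t : S, s + t = 0 → s = 0) {e f g : S} (he0 : e ≠ 0) (hf0 : f ≠ 0)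
    (he : ∀ s t, s + t = e → s = 0 ∨ t = 0) (hf : ∀ s t, s + t = f → s = 0 ∨ t = 0)
    (hg0 : g ≠ 0) (hge : g ≠ e) (hgf : g ≠ f) {d q : ℕ} (hdq : q + 2 ≤ 2 * d)
    (h : d • g = e + q • f) : ¬ Algebra.FormallySmooth ℂ (AddMonoidAlgebra ℂ S) := by
  intro hsm
  classical
  let J (n : ℕ) : Ideal ℂ[X] := Ideal.span {X ^ n}
  have hJ : J (q + 2) ≤ J 2 := by
    rw [Ideal.span_singleton_le_span_singleton]
    exact pow_dvd_pow X (by omega)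
  let x : ℂ[X] ⧸ J 2 := Ideal.Quotient.mk _ X
  have hx : x * x = 0 := by
    rw [← map_mul, Ideal.Quotient.eq_zero_iff_mem, Ideal.mem_span_singleton, sq]
  -- The tangent vector at the closed orbit in the directions `e` and `f`. It is multiplicative
  -- because a sum of nonzero elements is neither 0, `e` nor `f`, while products of its values there
  -- vanish by `x * x = 0`.
  let χ : Multiplicative S →* ℂ[X] ⧸ J 2 :=
    { toFun := fun s => if s.toAdd = 0 then 1 else if s.toAdd = e ∨ s.toAdd = f then x else 0
      map_one' := by simp
      map_mul' := by
        intro s t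
        rw [toAdd_mul]
        generalize s.toAdd = s
        generalize t.toAdd = t
        by_cases hs : s = 0
        · simp [hs]
        by_cases ht : t = 0
        · simp [ht]
        have h1 : s + t ≠ 0 := fun h => hs (hS s t h)
        have h2 : s + t ≠ e := fun h => (he s t h).elim hs ht
        have h3 : s + t ≠ f := fun h => (hf s t h).elim hs ht
        simp only [h1, h2, h3, hs, ht, or_self, if_false]
        split_ifs <;> simp [hx] }
  let π : (ℂ[X] ⧸ J (q + 2)) →ₐ[ℂ] (ℂ[X] ⧸ J 2) := Ideal.Quotient.factorₐ ℂ hJ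
  have hπ : ∀ p : ℂ[X], π (Ideal.Quotient.mk _ p) = Ideal.Quotient.mk _ p := fun p => rfl
  have hsurj : Function.Surjective π := fun y => by
    obtain ⟨p, rfl⟩ := Ideal.Quotient.mk_surjective y
    exact ⟨_, hπ p⟩
  have hnil : IsNilpotent (RingHom.ker (π : (ℂ[X] ⧸ J (q + 2)) →+* (ℂ[X] ⧸ J 2))) := by
    have hle : RingHom.ker (π : (ℂ[X] ⧸ J (q + 2)) →+* (ℂ[X] ⧸ J 2)) ≤
        (J 1).map (Ideal.Quotient.mk (J (q + 2))) := by
      intro y hy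
      obtain ⟨p, rfl⟩ := Ideal.Quotient.mk_surjective y
      have hy' : (Ideal.Quotient.mk (J 2)) p = 0 := hy
      rw [Ideal.Quotient.eq_zero_iff_mem, Ideal.mem_span_singleton] at hy'
      refine Ideal.mem_map_of_mem _ (Ideal.mem_span_singleton.2 ((pow_dvd_pow X ?_).trans hy'))
      norm_num
    refine ⟨q + 2, le_bot_iff.1 ((Ideal.pow_right_mono hle (q + 2)).trans ?_)⟩
    rw [← Ideal.map_pow, Ideal.span_singleton_pow, pow_one, Ideal.map_quotient_self]
  obtain ⟨F, hF⟩ : ∃ F : AddMonoidAlgebra ℂ S →ₐ[ℂ] ℂ[X] ⧸ J (q + 2),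
      ∀ y, π (F y) = AddMonoidAlgebra.lift ℂ _ S χ y :=
    ⟨Algebra.FormallySmooth.liftOfSurjective _ π hsurj hnil,
      Algebra.FormallySmooth.liftOfSurjective_apply _ π hsurj hnil⟩
  let ψ : Multiplicative S →* ℂ[X] ⧸ J (q + 2) := (AddMonoidAlgebra.lift ℂ _ S).symm F
  have hψ : ∀ s : S, π (ψ (Multiplicative.ofAdd s)) = χ (Multiplicative.ofAdd s) := fun s => by
    change π (F (AddMonoidAlgebra.single s 1)) = _
    rw [hF, AddMonoidAlgebra.lift_single, one_smul]
  -- A lift to order `q + 2` must still satisfy the monoid relation, which the orders of vanishing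
  -- forbid.
  have hrel : ψ (Multiplicative.ofAdd g) ^ d =
      ψ (Multiplicative.ofAdd e) * ψ (Multiplicative.ofAdd f) ^ q := by
    simpa only [ofAdd_add, ofAdd_nsmul, map_mul, map_pow] using
      congrArg (fun s => ψ (Multiplicative.ofAdd s)) h
  have hχe : χ (Multiplicative.ofAdd e) = Ideal.Quotient.mk _ X := by
    simp [χ, he0, x]
  have hχf : χ (Multiplicative.ofAdd f) = Ideal.Quotient.mk _ X := by
    simp [χ, hf0, x]
  have hχg : χ (Multiplicative.ofAdd g) = 0 := by
    simp [χ, hg0, hge, hgf]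
  have hψe := hψ e
  have hψf := hψ f
  have hψg := hψ g
  rw [hχe] at hψe
  rw [hχf] at hψf
  rw [hχg] at hψg
  obtain ⟨E', hE'⟩ := Ideal.Quotient.mk_surjective (ψ (Multiplicative.ofAdd e))
  obtain ⟨F', hF'⟩ := Ideal.Quotient.mk_surjective (ψ (Multiplicative.ofAdd f))
  obtain ⟨G', hG'⟩ := Ideal.Quotient.mk_surjective (ψ (Multiplicative.ofAdd g))
  rw [← hE', hπ, Ideal.Quotient.eq, Ideal.mem_span_singleton] at hψe
  rw [← hF', hπ, Ideal.Quotient.eq, Ideal.mem_span_singleton] at hψf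
  rw [← hG', hπ, Ideal.Quotient.eq_zero_iff_mem, Ideal.mem_span_singleton] at hψg
  rw [← hE', ← hF', ← hG', ← map_pow, ← map_pow, ← map_mul, Ideal.Quotient.eq,
    Ideal.mem_span_singleton] at hrel
  exact not_X_pow_dvd hdq hψe hψf hψg hrel

lemma exists_eq_smul_of_pairing_eq_zero {w : N} {m : M} (hw : IsCoprime (w 0) (w 1))
    (h : pairing w m = 0) : ∃ c : ℤ, m 0 = c * w 1 ∧ m 1 = -(c * w 0) := by
  obtain ⟨a, b, hab⟩ := hw
  rw [pairing_apply] at h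
  exact ⟨m 0 * b - m 1 * a, by linear_combination (-m 0) * hab + a * h,
    by linear_combination (-m 1) * hab + b * h⟩

/-- A primitive character which vanishes on one edge of a cone is irreducible in the dual
monoid. -/
lemma eq_zero_or_eq_zero_of_add_eq {S : AddSubmonoid M} {v w : N} (hw : IsCoprime (w 0) (w 1))
    (hS : ∀ m ∈ S, 0 ≤ pairing v m ∧ 0 ≤ pairing w m) {e : S} (hew : pairing w e = 0)
    {a : ℤ} (ha : a = 1 ∨ a = -1) (he0 : e.1 0 = a * w 1) (he1 : e.1 1 = -(a * w 0))
    (hev : 0 < pairing v e) (s t : S) (hst : s + t = e) : s = 0 ∨ t = 0 := by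
  have hw' : pairing w s + pairing w t = 0 := by
    rw [← map_add, ← hew, ← hst]
    rfl
  have hs := hS s s.2
  have ht := hS t t.2
  obtain ⟨c, hc0, hc1⟩ := exists_eq_smul_of_pairing_eq_zero hw
    (show pairing w s = 0 by linarith [hs.2, ht.2])
  obtain ⟨c', hc0', hc1'⟩ := exists_eq_smul_of_pairing_eq_zero hw
    (show pairing w t = 0 by linarith [hs.2, ht.2])
  have h0 : c * w 1 + c' * w 1 = a * w 1 := by
    rw [← hc0, ← hc0', ← he0, ← hst]
    rfl
  have h1 : c * w 0 + c' * w 0 = a * w 0 := by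
    have : s.1 1 + t.1 1 = e.1 1 := by
      rw [← hst]
      rfl
    linarith
  have hsum : c + c' = a := by
    obtain ⟨p, q, hpq⟩ := hw
    linear_combination (a - c - c') * hpq + p * h1 + q * h0
  set D := w 1 * v 0 - w 0 * v 1 with hD
  have hvs : pairing v s = c * D := by
    rw [pairing_apply, hc0, hc1]
    ring
  have hvt : pairing v t = c' * D := by
    rw [pairing_apply, hc0', hc1']
    ring
  have hve : pairing v e = a * D := by
    rw [pairing_apply, he0, he1]
    ring
  have h2 := hs.1
  have h3 := ht.1
  rw [hvs] at h2
  rw [hvt] at h3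
  rw [hve] at hev
  -- Nonnegativity on `v` gives `c` and `c'` the sign of `a`, and integers of one sign with sum `±1`
  -- include a zero.
  have hz : c = 0 ∨ c' = 0 := by
    rcases ha with rfl | rfl
    · have hD' : 0 < D := by linarith
      have := nonneg_of_mul_nonneg_left h2 hD'
      have := nonneg_of_mul_nonneg_left h3 hD'
      omega
    · have hD' : 0 < -D := by linarith
      have := nonneg_of_mul_nonneg_left (show 0 ≤ (-c) * (-D) by linarith) hD'
      have := nonneg_of_mul_nonneg_left (show 0 ≤ (-c') * (-D) by linarith) hD'
      omega
  rcases hz with rfl | rfl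
  · left
    apply Subtype.ext
    ext i
    fin_cases i <;> simp [hc0, hc1]
  · right
    apply Subtype.ext
    ext i
    fin_cases i <;> simp [hc0', hc1']

/-- Under the two pairings the dual monoid contains `e = (d, 0)`, `f = (0, d)` and some `g = (1, q)`
with `0 ≤ q < d`. Thus `d g = e + q f`, and for `d > 1` the obstruction applies. -/
theorem det_eq_one_of_smooth {v w : N} (hv : IsCoprime (v 0) (v 1)) (hw : IsCoprime (w 0) (w 1))
    (hd : 0 < det v w) (hsm : Algebra.Smooth ℂ (coordinateRing (latticeCone {v, w}))) :
    det v w = 1 := by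
  by_contra hne
  have hmem : ∀ m : M, m ∈ dualMonoid (latticeCone {v, w}) ↔
      0 ≤ pairing v m ∧ 0 ≤ pairing w m := by
    intro m
    rw [mem_dualMonoid_latticeCone]
    simp
  set d := det v w with hd_def
  have hd1 : 1 < d := by omega
  obtain ⟨p, r, hpr⟩ := id hv
  -- The character `(p, r)` pairs to 1 with `v`; subtracting `n` times `f₀` preserves this and
  -- reduces its pairing with `w` modulo `d`.
  let n : ℤ := (p * w 0 + r * w 1) / d
  let q : ℤ := (p * w 0 + r * w 1) % d
  have hq0 : 0 ≤ q := Int.emod_nonneg _ hd.ne'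
  have hqd : q < d := Int.emod_lt_of_pos _ hd
  have hqn : q + d * n = p * w 0 + r * w 1 := Int.emod_add_mul_ediv _ _
  let e₀ : M := ![w 1, -w 0]
  let f₀ : M := ![-v 1, v 0]
  let g₀ : M := ![p + n * v 1, r - n * v 0]
  have hev : pairing v e₀ = d := by simp [pairing_apply, e₀, hd_def, det]; ring
  have hew : pairing w e₀ = 0 := by simp [pairing_apply, e₀]; ring
  have hfv : pairing v f₀ = 0 := by simp [pairing_apply, f₀]; ring
  have hfw : pairing w f₀ = d := by simp [pairing_apply, f₀, hd_def, det]; ring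
  have hgv : pairing v g₀ = 1 := by
    simp [pairing_apply, g₀]
    linear_combination hpr
  have hgw : pairing w g₀ = q := by
    simp [pairing_apply, g₀]
    rw [hd_def, det] at hqn
    linear_combination -hqn
  let e : dualMonoid (latticeCone {v, w}) := ⟨e₀, (hmem _).2 ⟨by omega, by omega⟩⟩
  let f : dualMonoid (latticeCone {v, w}) := ⟨f₀, (hmem _).2 ⟨by omega, by omega⟩⟩
  let g : dualMonoid (latticeCone {v, w}) := ⟨g₀, (hmem _).2 ⟨by omega, by omega⟩⟩
  have hinj : ∀ m m' : M, pairing v m = pairing v m' → pairing w m = pairing w m' → m = m' := by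
    intro m m' h1 h2
    simp only [pairing_apply] at h1 h2
    have h3 : v 0 * w 1 - v 1 * w 0 ≠ 0 := hd.ne'
    ext i
    fin_cases i
    · apply mul_right_cancel₀ h3
      change m 0 * _ = m' 0 * _
      linear_combination w 1 * h1 - v 1 * h2
    · apply mul_right_cancel₀ h3
      change m 1 * _ = m' 1 * _
      linear_combination v 0 * h2 - w 0 * h1
  have hval : ∀ {a b : dualMonoid (latticeCone {v, w})}, a = b →
      pairing v a = pairing v b ∧ pairing w a = pairing w b := by
    rintro a _ rfl
    exact ⟨rfl, rfl⟩
  refine not_formallySmooth_of_relation (S := dualMonoid (latticeCone {v, w}))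
    (e := e) (f := f) (g := g) (d := d.toNat) (q := q.toNat) ?_ ?_ ?_ ?_ ?_ ?_ ?_ ?_ ?_ ?_
    hsm.formallySmooth
  · intro s t hst
    obtain ⟨h1, h2⟩ := hval hst
    have hs := (hmem s).1 s.2
    have ht := (hmem t).1 t.2
    simp only [AddSubmonoid.coe_add, map_add, AddSubmonoid.coe_zero, map_zero] at h1 h2
    exact Subtype.ext (hinj s 0 (by rw [map_zero]; omega) (by rw [map_zero]; omega))
  · intro h
    have : d = pairing v 0 := hev.symm.trans (hval h).1
    rw [map_zero] at this
    omega
  · intro h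
    have : d = pairing w 0 := hfw.symm.trans (hval h).2
    rw [map_zero] at this
    omega
  · exact eq_zero_or_eq_zero_of_add_eq hw (fun m hm => (hmem m).1 hm) hew (Or.inl rfl)
      (by simp [e, e₀]) (by simp [e, e₀]) (by rw [hev]; exact hd)
  · exact eq_zero_or_eq_zero_of_add_eq hv (fun m hm => ((hmem m).1 hm).symm) hfv (Or.inr rfl)
      (by simp [f, f₀]) (by simp [f, f₀]) (by rw [hfw]; exact hd)
  · intro h
    have : 1 = pairing v 0 := hgv.symm.trans (hval h).1
    rw [map_zero] at this
    omega
  · intro h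
    have : 1 = d := hgv.symm.trans ((hval h).1.trans hev)
    omega
  · intro h
    have : (1 : ℤ) = 0 := hgv.symm.trans ((hval h).1.trans hfv)
    omega
  · omega
  · apply Subtype.ext
    apply hinj
    · change pairing v (d.toNat • g₀) = pairing v (e₀ + q.toNat • f₀)
      rw [map_add, map_nsmul, map_nsmul, hgv, hev, hfv]
      simp [hd.le]
    · change pairing w (d.toNat • g₀) = pairing w (e₀ + q.toNat • f₀)
      rw [map_add, map_nsmul, map_nsmul, hgw, hew, hfw]
      simp [hd.le, hq0, mul_comm]

/-! ### The weighted projective plane `ℙ(1, 2, 2k + 1)` and its resolution -/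

/-- The rays of the fan of `ℙ(1, 2, 2k + 1)`. -/
def planeRays (k : ℕ) : Set N := {![-2, -(2 * (k : ℤ) + 1)], ![1, 0], ![0, 1]}

/-- The rays of the fan of the minimal desingularization of `ℙ(1, 2, 2k + 1)`. -/
def resolutionRays (k : ℕ) : Set N :=
  {![1, 0], ![0, 1], ![-1, -(k : ℤ)], ![-2, -(2 * (k : ℤ) + 1)], ![-1, -((k : ℤ) + 1)], ![0, -1]}

lemma finite_resolutionRays (k : ℕ) : (resolutionRays k).Finite := by
  simp [resolutionRays]

lemma planeRays_subset (k : ℕ) : planeRays k ⊆ resolutionRays k := by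
  rintro v (rfl | rfl | rfl) <;> simp [resolutionRays]

lemma isCoprime_of_mem_resolutionRays {k : ℕ} :
    ∀ v ∈ resolutionRays k, IsCoprime (v 0) (v 1) := by
  rintro v (rfl | rfl | rfl | rfl | rfl | rfl)
  · exact ⟨1, 0, by simp⟩
  · exact ⟨0, 1, by simp⟩
  · exact ⟨-1, 0, by simp⟩
  · exact ⟨k, -1, by simp; ring⟩
  · exact ⟨-1, 0, by simp⟩
  · exact ⟨0, -1, by simp⟩

/-- The fan of `ℙ(1, 2, 2k + 1)`. -/
def planeFan (k : ℕ) : Fan :=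
  Fan.ofRays (planeRays k) ((finite_resolutionRays k).subset (planeRays_subset k))
    fun v hv => isCoprime_of_mem_resolutionRays v (planeRays_subset k hv)

/-- The fan of the minimal desingularization of `ℙ(1, 2, 2k + 1)`. -/
def resolutionFan (k : ℕ) : Fan :=
  Fan.ofRays (resolutionRays k) (finite_resolutionRays k) isCoprime_of_mem_resolutionRays

lemma rayGenerators_planeFan (k : ℕ) : (planeFan k).rayGenerators = planeRays k :=
  Fan.rayGenerators_ofRays _ _ _

lemma rayGenerators_resolutionFan (k : ℕ) :
    (resolutionFan k).rayGenerators = resolutionRays k :=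
  Fan.rayGenerators_ofRays _ _ _

lemma isComplete_planeFan (k : ℕ) : (planeFan k).IsComplete := by
  refine Fan.isComplete_ofRays _ _ fun x => ?_
  have hk : (0 : ℝ) ≤ k := k.cast_nonneg
  rcases le_or_gt 0 (x 0) with h0 | h0
  · have hk0 := mul_nonneg hk h0
    rcases le_or_gt 0 (x 1) with h1 | h1
    · refine ⟨![1, 0], ![0, 1], ?_, ?_⟩
      · simp [Adjacent, planeRays, det]
      · simp [rdet, h0, h1]
    · refine ⟨![-2, -(2 * (k : ℤ) + 1)], ![1, 0], ?_, ?_⟩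
      · simp [Adjacent, planeRays, det]
        omega
      · simp [rdet]
        constructor <;> linarith
  · have hk0 := mul_nonneg hk (neg_nonneg.2 h0.le)
    rcases le_or_gt ((2 * k + 1) * x 0) (2 * x 1) with h1 | h1
    · refine ⟨![0, 1], ![-2, -(2 * (k : ℤ) + 1)], ?_, ?_⟩
      · simp [Adjacent, planeRays, det]
        omega
      · simp [rdet]
        constructor <;> linarith
    · refine ⟨![-2, -(2 * (k : ℤ) + 1)], ![1, 0], ?_, ?_⟩
      · simp [Adjacent, planeRays, det]
        omega
      · simp [rdet]
        constructor <;> linarith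

/-- In the left half-plane the rays have slopes `k`, `k + 1/2` and `k + 1`, so comparing the slope
of `x` with these locates its sector. -/
lemma isComplete_resolutionFan (k : ℕ) : (resolutionFan k).IsComplete := by
  refine Fan.isComplete_ofRays _ _ fun x => ?_
  rcases le_or_gt 0 (x 0) with h0 | h0
  · rcases le_or_gt 0 (x 1) with h1 | h1
    · refine ⟨![1, 0], ![0, 1], ?_, ?_⟩
      · simp [Adjacent, resolutionRays, det]
      · simp [rdet, h0, h1]
    · refine ⟨![0, -1], ![1, 0], ?_, ?_⟩
      · simp [Adjacent, resolutionRays, det]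
      · simp [rdet, h0, h1.le]
  · rcases le_or_gt (k * x 0) (x 1) with h1 | h1
    · refine ⟨![0, 1], ![-1, -(k : ℤ)], ?_, ?_⟩
      · simp [Adjacent, resolutionRays, det]
      · simp [rdet]
        constructor <;> linarith
    rcases le_or_gt ((2 * k + 1) * x 0) (2 * x 1) with h2 | h2
    · refine ⟨![-1, -(k : ℤ)], ![-2, -(2 * (k : ℤ) + 1)], ?_, ?_⟩
      · simp [Adjacent, resolutionRays, det]
        omega
      · simp [rdet]
        constructor <;> linarith
    rcases le_or_gt ((k + 1) * x 0) (x 1) with h3 | h3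
    · refine ⟨![-2, -(2 * (k : ℤ) + 1)], ![-1, -((k : ℤ) + 1)], ?_, ?_⟩
      · simp [Adjacent, resolutionRays, det]
        omega
      · simp [rdet]
        constructor <;> linarith
    · refine ⟨![-1, -((k : ℤ) + 1)], ![0, -1], ?_, ?_⟩
      · simp [Adjacent, resolutionRays, det]
        omega
      · simp [rdet]
        constructor <;> linarith

lemma isNonsingular_resolutionFan (k : ℕ) : (resolutionFan k).IsNonsingular := by
  intro σ hσ
  cases (show FanCone (resolutionRays k) σ from hσ) with
  | bot => exact smooth_bot
  | ray v hv => exact smooth_latticeCone_singleton (isCoprime_of_mem_resolutionRays v hv)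
  | pair v w h =>
    apply smooth_latticeCone_pair
    obtain ⟨hv, hw, hd, hu⟩ := h
    simp only [resolutionRays, Set.forall_mem_insert, Set.mem_singleton_iff, forall_eq] at hu
    -- In each ordered pair of rays the determinant is nonpositive, another ray lies between, or the
    -- determinant is 1.
    rcases hv with rfl | rfl | rfl | rfl | rfl | rfl <;>
      rcases hw with rfl | rfl | rfl | rfl | rfl | rfl <;>
      simp [det] at hd hu ⊢ <;> omega

/-- The value of a linear functional at an interior lattice point of a unimodular cone. -/
lemma add_le_of_mem_interior {v w u : N} (hd : det v w = 1) (h1 : 0 < det v u)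
    (h2 : 0 < det u w) (a b : ℤ) (hv : 0 ≤ a * v 0 + b * v 1) (hw : 0 ≤ a * w 0 + b * w 1) :
    (a * v 0 + b * v 1) + (a * w 0 + b * w 1) ≤ a * u 0 + b * u 1 := by
  -- By unimodularity `u = det u w • v + det v u • w`, with both coefficients at least 1.
  have : a * u 0 + b * u 1 =
      det u w * (a * v 0 + b * v 1) + det v u * (a * w 0 + b * w 1) := by
    simp only [det] at hd ⊢
    linear_combination -(a * u 0 + b * u 1) * hd
  rw [this]
  nlinarith

lemma planeRays_adjacent {k : ℕ} {a b : N} (h : Adjacent (planeRays k) a b) :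
    (a = ![1, 0] ∧ b = ![0, 1]) ∨ (a = ![0, 1] ∧ b = ![-2, -(2 * (k : ℤ) + 1)]) ∨
      (a = ![-2, -(2 * (k : ℤ) + 1)] ∧ b = ![1, 0]) := by
  obtain ⟨ha, hb, hd, -⟩ := h
  rcases ha with rfl | rfl | rfl <;> rcases hb with rfl | rfl | rfl <;> simp [det] at hd ⊢ <;> omega

/-- No ray of the resolution passes through the interior of a unimodular cone contained in a cone
of the fan of `ℙ(1, 2, 2k + 1)`. -/
lemma not_mem_interior {k : ℕ} (hk : 1 ≤ k) {a b v w : N} (hab : Adjacent (planeRays k) a b)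
    (hv : v ≠ 0) (hw : w ≠ 0) (hd : det v w = 1) (hav : 0 ≤ det a v) (hvb : 0 ≤ det v b)
    (haw : 0 ≤ det a w) (hwb : 0 ≤ det w b) {u : N} (hu : u ∈ resolutionRays k)
    (h1 : 0 < det v u) (h2 : 0 < det u w) : False := by
  have hk' : (1 : ℤ) ≤ k := by exact_mod_cast hk
  have key := add_le_of_mem_interior hd h1 h2
  have hne : ∀ {v : N}, v ≠ 0 → v 0 = 0 → v 1 ≠ 0 := fun hv h0 h1 => hv (by
    ext i; fin_cases i <;> assumption)
  have pos : ∀ {c e : ℤ}, 1 ≤ c * v 0 + e * v 1 → 1 ≤ c * w 0 + e * w 1 →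
      2 ≤ c * u 0 + e * u 1 := fun {c e} hv hw => by
    have := key c e (by omega) (by omega)
    omega
  have nonneg : ∀ {c e : ℤ}, 0 ≤ c * v 0 + e * v 1 → 0 ≤ c * w 0 + e * w 1 →
      0 ≤ c * u 0 + e * u 1 := fun hv hw => by
    have := key _ _ hv hw
    omega
  rcases planeRays_adjacent hab with ⟨rfl, rfl⟩ | ⟨rfl, rfl⟩ | ⟨rfl, rfl⟩ <;>
    simp [det] at hav hvb haw hwb
  -- In each case `e1` and `e2` place `u` in the big cone, leaving only the rays there. Here `x + y`
  -- is 1 on both edges.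
  · have l : ∀ {v : N}, v ≠ 0 → 0 ≤ v 0 → 0 ≤ v 1 → 1 ≤ 1 * v 0 + 1 * v 1 := fun hv h0 h1 => by
      have := hne hv
      omega
    have e1 := nonneg (c := 1) (e := 0) (by linarith) (by linarith)
    have e2 := nonneg (c := 0) (e := 1) (by linarith) (by linarith)
    have e3 := pos (l hv hvb hav) (l hw hwb haw)
    rcases hu with rfl | rfl | rfl | rfl | rfl | rfl <;> simp at e1 e2 e3
  -- The functional `-(k + 1) x + y` is 1 at all three rays in this cone: `(0, 1)`, `(-1, -k)` and
  -- `(-2, -(2k + 1))`.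
  · have l : ∀ {v : N}, v ≠ 0 → v 0 ≤ 0 → 0 ≤ -(v 0 * (2 * k + 1)) + v 1 * 2 →
        1 ≤ (-(k + 1) : ℤ) * v 0 + 1 * v 1 := fun {v} hv h0 h1 => by
      by_contra! hc
      have h2 : v 0 = 0 := by linarith
      rw [h2] at h1 hc
      have := hne hv h2
      omega
    have e1 := nonneg (c := -1) (e := 0) (by linarith) (by linarith)
    have e2 := nonneg (c := -(2 * k + 1)) (e := 2) (by linarith) (by linarith)
    have e3 := pos (l hv (by linarith) (by linarith)) (l hw (by linarith) (by linarith))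
    rcases hu with rfl | rfl | rfl | rfl | rfl | rfl <;> simp at e1 e2 e3 <;> linarith
  -- Two functionals serve this cone: `x - y` is 1 at `(1, 0)` and `(0, -1)`, and `k x - y` is 1 at
  -- `(-2, -(2k + 1))`, `(-1, -(k + 1))` and `(0, -1)`. Their positivity on the cone needs `k ≥ 1`.
  · have l1 : ∀ {v : N}, v ≠ 0 → v 1 ≤ 0 → 0 ≤ (2 * k + 1) * v 0 - 2 * v 1 →
        1 ≤ 1 * v 0 + (-1) * v 1 := fun {v} hv h1 h2 => by
      by_contra! hc
      have h3 : v 0 ≤ v 1 := by linarith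
      have h4 : 0 ≤ (k - 1 : ℤ) * (-v 0) := mul_nonneg (by linarith) (by linarith)
      have := hne hv (by linarith)
      exact this (by linarith)
    have l2 : ∀ {v : N}, v ≠ 0 → v 1 ≤ 0 → 0 ≤ (2 * k + 1) * v 0 - 2 * v 1 →
        1 ≤ (k : ℤ) * v 0 + (-1) * v 1 := fun {v} hv h1 h2 => by
      by_contra! hc
      have h3 : 0 ≤ v 0 := by linarith
      have h4 : v 0 = 0 := by nlinarith
      rw [h4] at hc
      have := hne hv h4
      omega
    have e1 := nonneg (c := 2 * k + 1) (e := -2) (by linarith) (by linarith)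
    have e2 := nonneg (c := 0) (e := -1) (by linarith) (by linarith)
    have e3 := pos (l1 hv (by linarith) (by linarith)) (l1 hw (by linarith) (by linarith))
    have e4 := pos (l2 hv (by linarith) (by linarith)) (l2 hw (by linarith) (by linarith))
    rcases hu with rfl | rfl | rfl | rfl | rfl | rfl <;> simp at e1 e2 e3 e4 <;> linarith

theorem isMinimalDesingularization_resolutionFan {k : ℕ} (hk : 1 ≤ k) :
    (resolutionFan k).IsMinimalDesingularization (planeFan k) := by
  refine ⟨⟨(isComplete_planeFan k).isSubdivision (isComplete_resolutionFan k) ?_,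
    isNonsingular_resolutionFan k⟩, fun D hD => ?_⟩
  · rw [rayGenerators_planeFan, rayGenerators_resolutionFan]
    exact planeRays_subset k
  · refine (isComplete_resolutionFan k).mapsTo_of_pairs fun v w hvw hmem u hu h1 h2 => ?_
    rw [rayGenerators_resolutionFan] at hu
    have hd := det_eq_one_of_smooth hvw.1.1 hvw.2.1.1 hvw.2.2.1 (hD.2 _ hmem)
    have hv := ne_zero_of_isCoprime hvw.1.1
    have hw := ne_zero_of_isCoprime hvw.2.1.1
    obtain ⟨σ, hσ, hle⟩ := hD.1.1 _ hmem
    have hvσ : toReal v ∈ σ := hle (toReal_mem_latticeCone (by simp))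
    have hwσ : toReal w ∈ σ := hle (toReal_mem_latticeCone (by simp))
    -- Only a two-dimensional cone can contain the independent vectors `v` and `w`.
    cases (show FanCone (planeRays k) σ from hσ) with
    | bot => exact toReal_ne_zero hv hvσ
    | ray a ha =>
      obtain ⟨p, -, hp⟩ := mem_latticeCone_singleton.1 hvσ
      obtain ⟨q, -, hq⟩ := mem_latticeCone_singleton.1 hwσ
      apply rdet_toReal_ne_zero hvw.2.2.1
      rw [hp, hq, rdet_smul, rdet_swap, rdet_smul, rdet_self]
      simp
    | pair a b hab =>
      rw [toReal_mem_latticeCone_pair_iff hab.2.2.1] at hvσ hwσ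
      exact not_mem_interior hk hab hv hw hd hvσ.1 hvσ.2 hwσ.1 hwσ.2 hu h1 h2

lemma isWeightedProjectivePlane_planeFan (k : ℕ) :
    (planeFan k).IsWeightedProjectivePlane 1 2 (2 * k + 1)
      ![-2, -(2 * (k : ℤ) + 1)] ![1, 0] ![0, 1] := by
  refine ⟨isComplete_planeFan k, rayGenerators_planeFan k, ?_, ?_⟩
  · refine Submodule.eq_top_iff'.2 fun x => ?_
    have h : x = x 0 • ![1, 0] + x 1 • ![0, 1] := by
      ext i
      fin_cases i <;> simp
    rw [h]
    exact add_mem (Submodule.smul_mem _ _ (Submodule.subset_span (by simp)))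
      (Submodule.smul_mem _ _ (Submodule.subset_span (by simp)))
  · ext i
    fin_cases i <;> simp

end ToricSurface

theorem mainTheorem4 (k : ℕ) (hk : 1 ≤ k) :
    (∃! Δ : ToricSurface.Fan,
      Δ.IsWeightedProjectivePlane 1 2 (2 * k + 1) ![-2, -(2 * (k : ℤ) + 1)] ![1, 0] ![0, 1]) ∧
    ∀ Δ : ToricSurface.Fan,
      Δ.IsWeightedProjectivePlane 1 2 (2 * k + 1) ![-2, -(2 * (k : ℤ) + 1)] ![1, 0] ![0, 1] →
      (∃! D : ToricSurface.Fan, D.IsMinimalDesingularization Δ) ∧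
      ∀ D : ToricSurface.Fan, D.IsMinimalDesingularization Δ ↔
        (D.IsComplete ∧
          D.rayGenerators =
            {![1, 0], ![0, 1], ![-1, -(k : ℤ)], ![-2, -(2 * (k : ℤ) + 1)],
              ![-1, -((k : ℤ) + 1)], ![0, -1]}) := by
  have hP := ToricSurface.isWeightedProjectivePlane_planeFan k
  have huniq : ∀ Δ : ToricSurface.Fan,
      Δ.IsWeightedProjectivePlane 1 2 (2 * k + 1) ![-2, -(2 * (k : ℤ) + 1)] ![1, 0] ![0, 1] →
      Δ = ToricSurface.planeFan k := fun Δ hΔ =>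
    hΔ.1.ext_rayGenerators hP.1 (hΔ.2.1.trans hP.2.1.symm)
  refine ⟨⟨_, hP, huniq⟩, fun Δ hΔ => ?_⟩
  obtain rfl := huniq Δ hΔ
  have hmin := ToricSurface.isMinimalDesingularization_resolutionFan hk
  refine ⟨⟨_, hmin, fun D hD => hD.unique hmin⟩, fun D => ⟨fun hD => ?_, fun hD => ?_⟩⟩
  · obtain rfl := hD.unique hmin
    exact ⟨ToricSurface.isComplete_resolutionFan k, ToricSurface.rayGenerators_resolutionFan k⟩
  · rwa [hD.1.ext_rayGenerators (ToricSurface.isComplete_resolutionFan k)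
      (hD.2.trans (ToricSurface.rayGenerators_resolutionFan k).symm)]
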